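/- Fix a field $\mathbf k$. The $0$-Hecke algebra $\mathcal H_n(0)$ is the $\mathbf k$-algebra with generators $\pi_1,\dots,\pi_{n-1}$ and relations $\pi_i^2=\pi_i$, $\pi_i\pi_{i+1}\pi_i=\pi_{i+1}\pi_i\pi_{i+1}$, and $\pi_i\pi_j=\pi_j\pi_i$ for $|i-j|>1$; put $\bar\pi_i=\pi_i-1$. A composition is a finite list of positive integers; $\alpha\cdot\beta$ denotes the concatenation of compositions, and, for nonempty compositions, $(\alpha_1,\dots,\alpha_l)\odot(\beta_1,\dots,\beta_m)=(\alpha_1,\dots,\alpha_{l-1},\alpha_l+\beta_1,\beta_2,\dots,\beta_m)$ is the near-concatenation. The ribbon $\mathrm{Diag}(\alpha)$ has $\alpha_i$ cells in its $i$-th row from the bottom, the first cell of each row lying directly above the last cell of the row below. For a sequence $\vec\beta$ of compositions, $\mathrm{Diag}(\vec\beta)$ consists of the ribbons $\mathrm{Diag}(\beta^{(1)}),\mathrm{Diag}(\beta^{(2)}),\dots$ from southwest to northeast, the first cell of each component lying one row above and one column to the right of the last cell of the previous one. A standard tableau of a shape with $n$ cells is a bijective filling with $1,\dots,n$ that increases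 from left to right along horizontally adjacent cells and from top to bottom along vertically adjacent cells. Let $\mathbf P_{\vec\beta}$ be the $\mathcal H_n(0)$-module whose $\mathbf k$-basis is the set of standard tableaux of shape $\mathrm{Diag}(\vec\beta)$, where $\bar\pi_i(T)$ is $-T$, $0$, or the tableau $s_i(T)$ obtained by interchanging $i$ and $i+1$, according as $i$ lies in a higher row than, in the same row as, or in a lower row of $T$ than $i+1$. For a single composition $\alpha$ write $\mathbf P_\alpha=\mathbf P_{(\alpha)}$. Let $\vec\alpha=(\alpha^{(1)},\dots,\alpha^{(\ell)})$ be a sequence of nonempty compositions of total size $n$. For $I\subseteq[\ell-1]=\{1,\dots,\ell-1\}$ let $\vec\alpha(I)$ be the sequence of $\ell-|I|$ compositions obtained from $\vec\alpha$ by replacing the $i$-th comma by $\odot$ for each $i\in I$. For $j\in[\ell-1]\setminus I$ let $\phi_j:\mathbf P_{\vec\alpha(I)}\to\mathbf P_{\vec\alpha(I\cup\{j\})}$ be the $\mathcal H_n(0)$-linear map that sends a standard tableau $T$ to the filling $T^{\downarrow}$ obtained by translating all components to the right of the $j$-th comma one unit down together with their entries if $T^{\downarrow}$ is standard, and to $0$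 otherwise. Set $$\mathcal C_i(\vec\alpha)=\bigoplus_{I\subseteq[\ell-1],\ |I|=i}\mathbf P_{\vec\alpha(I)},\qquad \partial_i(T)=\sum_{j\in[\ell-1]\setminus I}(-1)^{\#\{t\in I:\,t<j\}}\,\phi_j(T)\quad\text{for }T\in\mathbf P_{\vec\alpha(I)},\ |I|=i .$$ **Theorem.** $(\mathcal C(\vec\alpha),\partial)$ is a cochain complex of $\mathcal H_n(0)$-modules, that is, $\partial_{i+1}\circ\partial_i=0$ for all $i\ge 0$; it is acyclic in strictly positive cohomological degrees; and there is an isomorphism of $\mathcal H_n(0)$-modules $$H^0(\mathcal C(\vec\alpha))\cong\mathbf P_{\alpha^{(1)}\cdot\alpha^{(2)}\cdots\alpha^{(\ell)}} .$$ -/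

import Mathlib

open CategoryTheory

noncomputable section

namespace RibbonHecke

universe u

/-! ### Compositions and generalized ribbon diagrams -/

/-- A composition: a finite list of positive integers. -/
abbrev Comp : Type := List ℕ+

/-- The size `|α|` of a composition. -/
def Comp.size (α : Comp) : ℕ := (List.map (fun a : ℕ+ => (a : ℕ)) α).sum

/-- The size of a sequence of compositions. -/
def seqSize (α : List Comp) : ℕ := (α.map Comp.size).sum

/-- The near-concatenation
`(α₁, …, α_l) ⊙ (β₁, …, β_m) = (α₁, …, α_{l-1}, α_l + β₁, β₂, …, β_m)` of nonempty compositions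
(the values on empty lists are irrelevant). -/
def nearConcat : Comp → Comp → Comp
  | [], β => β
  | [a], [] => [a]
  | [a], b :: β => (a + b) :: β
  | a :: a' :: α, β => a :: nearConcat (a' :: α) β

/-- Auxiliary to `glueAt`: here the first comma of the sequence has the number `i`. -/
def glueFrom (I : Finset ℕ) : ℕ → List Comp → List Comp
  | _, [] => []
  | i, a :: α =>
    match glueFrom I (i + 1) α with
    | [] => [a]
    | b :: β => if i ∈ I then nearConcat a b :: β else a :: b :: β

/-- `α⃗(I)`: the `i`-th comma of the sequence `α⃗` (commas are numbered `1, …, ℓ - 1`) is replaced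
by `⊙` for each `i ∈ I`. -/
def glueAt (I : Finset ℕ) (α : List Comp) : List Comp := glueFrom I 1 α

/-- The cells of the ribbon of `α` whose southwestern cell is `(r, c)`, listed from southwest to
northeast. A cell is a pair (row, column); rows are numbered from bottom to top and columns from
left to right. The `i`-th row from the bottom has `αᵢ` cells, and its first cell lies directly above
the last cell of the row below. -/
def ribbonCells : ℕ → ℕ → Comp → List (ℕ × ℕ)
  | _, _, [] => []
  | r, c, a :: α =>
    (List.range (a : ℕ)).map (fun t => (r, c + t)) ++ ribbonCells (r + 1) (c + (a : ℕ) - 1) α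

/-- The cells of the generalized ribbon of a sequence of compositions, with southwestern cell
`(r, c)`. Each component starts one row above and one column to the right of the
northeastern cell of the previous component. -/
def seqCells : ℕ → ℕ → List Comp → List (ℕ × ℕ)
  | _, _, [] => []
  | r, c, a :: α => ribbonCells r c a ++ seqCells (r + a.length) (c + a.size - a.length + 1) α

/-- The diagram `Diag(α⃗)`, with southwestern cell `(1, 1)`. -/
def diag (α : List Comp) : Finset (ℕ × ℕ) := (seqCells 1 1 α).toFinset

/-- The number of rows of `Diag(α⃗)`. -/
def numRows (α : List Comp) : ℕ := (α.map List.length).sum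

/-! ### Standard tableaux -/

/-- A standard tableau of shape `D` with `n` entries: a bijective filling of the cells that
increases from left to right along horizontally adjacent cells and from top to bottom along
vertically adjacent cells. The entries `1, …, n` are represented by `0, …, n - 1`. -/
@[ext]
structure StdTableau (D : Finset (ℕ × ℕ)) (n : ℕ) where
  /-- the filling -/
  fill : D ≃ Fin n
  /-- if `y` lies immediately to the right of `x` then the entry of `x` is smaller -/
  horiz : ∀ x y : D, y.1 = (x.1.1, x.1.2 + 1) → fill x < fill y
  /-- if `x` lies immediately above `y` then the entry of `x` is smaller -/
  vert : ∀ x y : D, x.1 = (y.1.1 + 1, y.1.2) → fill x < fill y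

namespace StdTableau

variable {D : Finset (ℕ × ℕ)} {n : ℕ}

/-- The cell that contains a given entry. -/
def pos (T : StdTableau D n) (e : Fin n) : ℕ × ℕ := (T.fill.symm e).1

/-- The row (counted from the bottom) that contains a given entry. -/
def row (T : StdTableau D n) (e : Fin n) : ℕ := (T.pos e).1

end StdTableau

/-- The entry `i`, where `i ∈ {1, …, n - 1}` is represented by an element of `Fin (n - 1)`. -/
def lo {n : ℕ} (i : Fin (n - 1)) : Fin n := ⟨i.1, by omega⟩

/-- The entry `i + 1`, where `i ∈ {1, …, n - 1}`. -/
def hi {n : ℕ} (i : Fin (n - 1)) : Fin n := ⟨i.1 + 1, by omega⟩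

namespace StdTableau

variable {D : Finset (ℕ × ℕ)} {n : ℕ}

theorem pos_injective (T : StdTableau D n) : Function.Injective T.pos := fun _ _ h =>
  T.fill.symm.injective (Subtype.ext h)

theorem pos_mem (T : StdTableau D n) (e : Fin n) : T.pos e ∈ D := (T.fill.symm e).2

theorem pos_fill (T : StdTableau D n) (x : D) : T.pos (T.fill x) = x.1 := by simp [pos]

theorem ext_pos {T T' : StdTableau D n} (h : ∀ e, T.pos e = T'.pos e) : T = T' := by
  have : T.fill.symm = T'.fill.symm := Equiv.ext fun e => Subtype.ext (h e)
  have h2 : T.fill = T'.fill := by rw [← T.fill.symm_symm, this, Equiv.symm_symm]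
  exact StdTableau.ext h2

theorem horiz_pos (T : StdTableau D n) (e f : Fin n)
    (h : T.pos f = ((T.pos e).1, (T.pos e).2 + 1)) : e < f := by
  have := T.horiz (T.fill.symm e) (T.fill.symm f) h
  simpa using this

theorem vert_pos (T : StdTableau D n) (e f : Fin n)
    (h : T.pos e = ((T.pos f).1 + 1, (T.pos f).2)) : e < f := by
  have := T.vert (T.fill.symm e) (T.fill.symm f) h
  simpa using this

end StdTableau

theorem lo_lt_hi {n : ℕ} (i : Fin (n - 1)) : (lo i : Fin n) < hi i := by
  simp [lo, hi, Fin.lt_def]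

theorem swap_lt {n : ℕ} (i : Fin (n - 1)) {e f : Fin n} (h : e < f)
    (h' : ¬ (e = lo i ∧ f = hi i)) :
    Equiv.swap (lo i) (hi i) e < Equiv.swap (lo i) (hi i) f := by
  simp only [Equiv.swap_apply_def, lo, hi, Fin.lt_def, Fin.ext_iff] at *
  split_ifs <;> simp_all <;> omega

/-- `s_i(T)`: the entries `i` and `i + 1` are interchanged. It is standard if
the two entries are not horizontally adjacent and `i + 1` is not directly below `i`. -/
def StdTableau.interchange {D : Finset (ℕ × ℕ)} {n : ℕ} (T : StdTableau D n) (i : Fin (n - 1))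
    (hh : T.pos (hi i) ≠ ((T.pos (lo i)).1, (T.pos (lo i)).2 + 1))
    (hv : T.pos (lo i) ≠ ((T.pos (hi i)).1 + 1, (T.pos (hi i)).2)) :
    StdTableau D n where
  fill := T.fill.trans (Equiv.swap (lo i) (hi i))
  horiz x y hxy := by
    refine swap_lt i (T.horiz x y hxy) ?_
    rintro ⟨h1, h2⟩
    apply hh
    rw [← h1, ← h2, T.pos_fill, T.pos_fill, hxy]
  vert x y hxy := by
    refine swap_lt i (T.vert x y hxy) ?_
    rintro ⟨h1, h2⟩
    apply hv
    rw [← h1, ← h2, T.pos_fill, T.pos_fill, hxy]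

/-- `s_i(T)` when `i` is in a lower row of `T` than `i + 1`. -/
def StdTableau.swapEntries {D : Finset (ℕ × ℕ)} {n : ℕ} (T : StdTableau D n) (i : Fin (n - 1))
    (h : T.row (lo i) < T.row (hi i)) : StdTableau D n :=
  T.interchange i (fun e => by simp [StdTableau.row, e] at h)
    (fun e => by simp [StdTableau.row, e] at h)

theorem StdTableau.pos_interchange {D : Finset (ℕ × ℕ)} {n : ℕ} (T : StdTableau D n)
    (i : Fin (n - 1)) (hh hv) (e : Fin n) :
    (T.interchange i hh hv).pos e = T.pos (Equiv.swap (lo i) (hi i) e) := by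
  simp [pos, interchange]

theorem StdTableau.pos_swapEntries {D : Finset (ℕ × ℕ)} {n : ℕ} (T : StdTableau D n)
    (i : Fin (n - 1)) (h) (e : Fin n) :
    (T.swapEntries i h).pos e = T.pos (Equiv.swap (lo i) (hi i) e) :=
  T.pos_interchange i _ _ e

/-! ### The 0-Hecke algebra -/

/-- The defining relations of the 0-Hecke algebra on the generators `π₁, …, π_{n-1}`. -/
inductive HeckeRel (k : Type u) [Field k] (n : ℕ) :
    FreeAlgebra k (Fin (n - 1)) → FreeAlgebra k (Fin (n - 1)) → Prop
  | idem (i : Fin (n - 1)) :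
      HeckeRel k n (FreeAlgebra.ι k i * FreeAlgebra.ι k i) (FreeAlgebra.ι k i)
  | braid (i j : Fin (n - 1)) (h : i.1 + 1 = j.1) :
      HeckeRel k n (FreeAlgebra.ι k i * FreeAlgebra.ι k j * FreeAlgebra.ι k i)
        (FreeAlgebra.ι k j * FreeAlgebra.ι k i * FreeAlgebra.ι k j)
  | comm (i j : Fin (n - 1)) (h : i.1 + 1 < j.1 ∨ j.1 + 1 < i.1) :
      HeckeRel k n (FreeAlgebra.ι k i * FreeAlgebra.ι k j)
        (FreeAlgebra.ι k j * FreeAlgebra.ι k i)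

/-- The 0-Hecke algebra `H_n(0)` over the field `k`. -/
abbrev HeckeZero (k : Type u) [Field k] (n : ℕ) : Type u := RingQuot (HeckeRel k n)

/-- The generator `π_i` of `H_n(0)`. -/
def HeckeZero.gen (k : Type u) [Field k] {n : ℕ} (i : Fin (n - 1)) : HeckeZero k n :=
  RingQuot.mkAlgHom k (HeckeRel k n) (FreeAlgebra.ι k i)

/-! ### The tableau modules -/

/-- The `k`-vector space with basis the standard tableaux of shape `D` with `n` entries. -/
def TabModule (k : Type u) [Field k] (n : ℕ) (D : Finset (ℕ × ℕ)) : Type u := StdTableau D n →₀ k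

section TabModule

variable (k : Type u) [Field k] {n : ℕ} {D : Finset (ℕ × ℕ)}

instance : AddCommGroup (TabModule k n D) := inferInstanceAs (AddCommGroup (StdTableau D n →₀ k))

instance : Module k (TabModule k n D) := inferInstanceAs (Module k (StdTableau D n →₀ k))

/-- The basis vector of a standard tableau. -/
def TabModule.basisVec (T : StdTableau D n) : TabModule k n D := Finsupp.single T 1

/-- The `k`-linear map with prescribed values on the basis of standard tableaux. -/
def TabModule.lift {M : Type*} [AddCommGroup M] [Module k M] (f : StdTableau D n → M) :
    TabModule k n D →ₗ[k] M := Finsupp.linearCombination k f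

/-- The operator `π̄_i` on the span of the standard tableaux: `π̄_i(T)` is `-T`, `0` or
`s_i(T)` if `i` is in a higher row than, in the same row as, or in a lower row than `i + 1`. -/
def piBar (i : Fin (n - 1)) : TabModule k n D →ₗ[k] TabModule k n D :=
  TabModule.lift k fun T =>
    if h : T.row (lo i) < T.row (hi i) then TabModule.basisVec k (T.swapEntries i h)
    else if T.row (hi i) < T.row (lo i) then -TabModule.basisVec k T
    else 0

end TabModule

section Relations

variable (k : Type u) [Field k] {n : ℕ} {D : Finset (ℕ × ℕ)}

theorem TabModule.lift_basisVec {M : Type*} [AddCommGroup M] [Module k M]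
    (f : StdTableau D n → M) (T : StdTableau D n) :
    TabModule.lift k f (TabModule.basisVec k T) = f T := by
  exact (Finsupp.linearCombination_single k 1 T).trans (one_smul k _)

theorem TabModule.hom_ext {M : Type*} [AddCommGroup M] [Module k M]
    {f g : TabModule k n D →ₗ[k] M}
    (h : ∀ T, f (TabModule.basisVec k T) = g (TabModule.basisVec k T)) : f = g :=
  Finsupp.lhom_ext' fun T => LinearMap.ext_ring (h T)

theorem piBar_of_gt (i : Fin (n - 1)) {T : StdTableau D n} (h : T.row (hi i) < T.row (lo i)) :
    piBar k i (TabModule.basisVec k T) = -TabModule.basisVec k T := by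
  rw [piBar, TabModule.lift_basisVec, dif_neg h.not_gt, if_pos h]

theorem piBar_of_eq (i : Fin (n - 1)) {T : StdTableau D n} (h : T.row (lo i) = T.row (hi i)) :
    piBar k i (TabModule.basisVec k T) = 0 := by
  rw [piBar, TabModule.lift_basisVec, dif_neg h.not_lt, if_neg h.symm.not_lt]

theorem piBar_of_lt (i : Fin (n - 1)) {T : StdTableau D n} (h : T.row (lo i) < T.row (hi i)) :
    piBar k i (TabModule.basisVec k T) = TabModule.basisVec k (T.swapEntries i h) := by
  rw [piBar, TabModule.lift_basisVec, dif_pos h]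

/-- Auxiliary: the analogue of `piBar` on arbitrary words in the cells. -/
def wordOp (i : Fin (n - 1)) : ((Fin n → ℕ × ℕ) →₀ k) →ₗ[k] ((Fin n → ℕ × ℕ) →₀ k) :=
  Finsupp.linearCombination k fun w =>
    if (w (lo i)).1 < (w (hi i)).1 then Finsupp.single (w ∘ Equiv.swap (lo i) (hi i)) 1
    else if (w (hi i)).1 < (w (lo i)).1 then -Finsupp.single w 1
    else 0

/-- Auxiliary: a tableau is sent to the word of the positions of its entries. -/
def toWord : TabModule k n D →ₗ[k] ((Fin n → ℕ × ℕ) →₀ k) :=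
  Finsupp.lmapDomain k k StdTableau.pos

theorem toWord_basisVec (T : StdTableau D n) :
    toWord k (TabModule.basisVec k T) = Finsupp.single T.pos 1 := by
  exact Finsupp.mapDomain_single

theorem toWord_injective : Function.Injective (toWord k (n := n) (D := D)) :=
  Finsupp.mapDomain_injective fun _ _ h => StdTableau.ext_pos (congrFun h)

theorem toWord_piBar (i : Fin (n - 1)) (x : TabModule k n D) :
    toWord k (piBar k i x) = wordOp k i (toWord k x) := by
  suffices (toWord k).comp (piBar k i) = (wordOp k i).comp (toWord k (D := D)) from
    LinearMap.congr_fun this x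
  refine TabModule.hom_ext k fun T => ?_
  simp only [LinearMap.comp_apply, toWord_basisVec, wordOp, Finsupp.linearCombination_single,
    one_smul]
  rcases lt_trichotomy (T.row (lo i)) (T.row (hi i)) with h | h | h
  · rw [piBar_of_lt k i h, toWord_basisVec, if_pos (by exact h)]
    congr 1
  · rw [piBar_of_eq k i h, if_neg, if_neg, map_zero]
    · exact h.symm.not_lt
    · exact h.not_lt
  · rw [piBar_of_gt k i h, map_neg, toWord_basisVec, if_neg, if_pos]
    · exact h
    · exact h.not_gt

theorem wordOp_single (i : Fin (n - 1)) (w : Fin n → ℕ × ℕ) :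
    wordOp k i (Finsupp.single w 1) =
      if (w (lo i)).1 < (w (hi i)).1 then Finsupp.single (w ∘ Equiv.swap (lo i) (hi i)) 1
      else if (w (hi i)).1 < (w (lo i)).1 then -Finsupp.single w 1
      else 0 := by
  simp [wordOp]

theorem wordOp_sq (i : Fin (n - 1)) : wordOp k i * wordOp k i = -wordOp k i := by
  refine Finsupp.lhom_ext' fun w => LinearMap.ext_ring ?_
  simp only [LinearMap.comp_apply, Finsupp.lsingle_apply, Module.End.mul_apply,
    LinearMap.neg_apply]
  rcases lt_trichotomy (w (lo i)).1 (w (hi i)).1 with h | h | h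
  · simp [wordOp_single, h, h.not_gt]
  · simp [wordOp_single, h]
  · simp [wordOp_single, h, h.not_gt]

theorem wordOp_comm (i j : Fin (n - 1)) (hij : i.1 + 1 < j.1) :
    wordOp k i * wordOp k j = wordOp k j * wordOp k i := by
  have h1 : (lo i : Fin n) ≠ lo j := by simp [lo, Fin.ext_iff]; omega
  have h2 : (lo i : Fin n) ≠ hi j := by simp [lo, hi, Fin.ext_iff]; omega
  have h3 : (hi i : Fin n) ≠ lo j := by simp [lo, hi, Fin.ext_iff]; omega
  have h4 : (hi i : Fin n) ≠ hi j := by simp [hi, Fin.ext_iff]; omega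
  refine Finsupp.lhom_ext' fun w => LinearMap.ext_ring ?_
  simp only [LinearMap.comp_apply, Finsupp.lsingle_apply, Module.End.mul_apply]
  have e1 := Equiv.swap_apply_of_ne_of_ne h1 h2
  have e2 := Equiv.swap_apply_of_ne_of_ne h3 h4
  have e3 := Equiv.swap_apply_of_ne_of_ne h1.symm h3.symm
  have e4 := Equiv.swap_apply_of_ne_of_ne h2.symm h4.symm
  have e5 : (w ∘ Equiv.swap (lo j) (hi j)) ∘ Equiv.swap (lo i) (hi i) =
      (w ∘ Equiv.swap (lo i) (hi i)) ∘ Equiv.swap (lo j) (hi j) := by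
    funext e
    simp only [Function.comp_apply]
    congr 1
    simp only [Equiv.swap_apply_def]
    split_ifs <;> simp_all
  rcases lt_trichotomy (w (lo i)).1 (w (hi i)).1 with h | h | h <;>
  rcases lt_trichotomy (w (lo j)).1 (w (hi j)).1 with h' | h' | h' <;>
  simp [wordOp_single, h, h', h.not_gt, h'.not_gt, e1, e2, e3, e4, e5]

theorem wordOp_braid (i j : Fin (n - 1)) (hij : i.1 + 1 = j.1) :
    wordOp k i * wordOp k j * wordOp k i = wordOp k j * wordOp k i * wordOp k j := by
  have hj : (lo j : Fin n) = hi i := by simp [lo, hi, Fin.ext_iff]; omega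
  have h1 : (lo i : Fin n) ≠ hi i := by simp [lo, hi, Fin.ext_iff]
  have h2 : (lo i : Fin n) ≠ hi j := by simp [lo, hi, Fin.ext_iff]; omega
  have h3 : (hi i : Fin n) ≠ hi j := by simp [hi, Fin.ext_iff]; omega
  refine Finsupp.lhom_ext' fun w => LinearMap.ext_ring ?_
  simp only [LinearMap.comp_apply, Finsupp.lsingle_apply, Module.End.mul_apply]
  have e1 := Equiv.swap_apply_of_ne_of_ne h1 h2
  have e2 := Equiv.swap_apply_of_ne_of_ne h2.symm h3.symm
  have e5 : ((w ∘ Equiv.swap (lo i) (hi i)) ∘ Equiv.swap (hi i) (hi j)) ∘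
      Equiv.swap (lo i) (hi i) = ((w ∘ Equiv.swap (hi i) (hi j)) ∘ Equiv.swap (lo i) (hi i)) ∘
      Equiv.swap (hi i) (hi j) := by
    funext e
    simp only [Function.comp_apply]
    congr 1
    simp only [Equiv.swap_apply_def]
    split_ifs <;> simp_all
  rcases lt_trichotomy (w (lo i)).1 (w (hi i)).1 with h | h | h <;>
  rcases lt_trichotomy (w (hi i)).1 (w (hi j)).1 with h' | h' | h' <;>
  rcases lt_trichotomy (w (lo i)).1 (w (hi j)).1 with h'' | h'' | h'' <;>
  first
  | (exfalso; omega)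
  | simp [wordOp_single, hj, h, h', h'', h.not_gt, h'.not_gt, h''.not_gt, e1, e2, e5]

theorem piBar_sq (i : Fin (n - 1)) :
    (piBar k i * piBar k i : Module.End k (TabModule k n D)) = -piBar k i := by
  ext x : 1
  apply toWord_injective k
  simpa [toWord_piBar] using LinearMap.congr_fun (wordOp_sq k i) (toWord k x)

theorem piBar_comm (i j : Fin (n - 1)) (hij : i.1 + 1 < j.1) :
    (piBar k i * piBar k j : Module.End k (TabModule k n D)) = piBar k j * piBar k i := by
  ext x : 1
  apply toWord_injective k
  simpa [toWord_piBar] using LinearMap.congr_fun (wordOp_comm k i j hij) (toWord k x)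

theorem piBar_braid (i j : Fin (n - 1)) (hij : i.1 + 1 = j.1) :
    (piBar k i * piBar k j * piBar k i : Module.End k (TabModule k n D)) =
      piBar k j * piBar k i * piBar k j := by
  ext x : 1
  apply toWord_injective k
  simpa [toWord_piBar] using LinearMap.congr_fun (wordOp_braid k i j hij) (toWord k x)

variable (n D) in
/-- The representation of `H_n(0)` in which `π_i` acts as `π̄_i + 1`. -/
def heckeRep : HeckeZero k n →ₐ[k] Module.End k (TabModule k n D) :=
  RingQuot.liftAlgHom k ⟨FreeAlgebra.lift k fun i => piBar k i + 1, by
    intro x y h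
    induction h with
    | idem i =>
      simp only [map_mul, FreeAlgebra.lift_ι_apply]
      have := piBar_sq k (D := D) i
      calc _ = piBar k i * piBar k i + piBar k i + piBar k i + 1 := by noncomm_ring
        _ = _ := by rw [this]; abel
    | braid i j h =>
      simp only [map_mul, FreeAlgebra.lift_ι_apply]
      have hi := piBar_sq k (D := D) i
      have hj := piBar_sq k (D := D) j
      have hb := piBar_braid k (D := D) i j h
      calc _ = piBar k i * piBar k j * piBar k i + piBar k i * piBar k j + piBar k j * piBar k i
              + piBar k i * piBar k i + piBar k i + piBar k i + piBar k j + 1 := by noncomm_ring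
        _ = piBar k j * piBar k i * piBar k j + piBar k i * piBar k j + piBar k j * piBar k i
              + piBar k j * piBar k j + piBar k i + piBar k j + piBar k j + 1 := by
            rw [hi, hj, hb]; noncomm_ring
        _ = _ := by noncomm_ring
    | comm i j h =>
      simp only [map_mul, FreeAlgebra.lift_ι_apply]
      have hb : (piBar k i * piBar k j : Module.End k (TabModule k n D)) =
          piBar k j * piBar k i := by
        rcases h with h | h
        · exact piBar_comm k i j h
        · exact (piBar_comm k j i h).symm
      calc _ = piBar k i * piBar k j + piBar k i + piBar k j + 1 := by noncomm_ring
        _ = _ := by rw [hb]; noncomm_ring⟩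

/-- The `H_n(0)`-module structure on the span of the standard tableaux. -/
instance : Module (HeckeZero k n) (TabModule k n D) :=
  Module.compHom _ (heckeRep k n D).toRingHom

theorem HeckeZero.smul_def (h : HeckeZero k n) (x : TabModule k n D) :
    h • x = heckeRep k n D h x := rfl

theorem HeckeZero.gen_smul (i : Fin (n - 1)) (x : TabModule k n D) :
    HeckeZero.gen k i • x = piBar k i x + x := by
  simp [HeckeZero.smul_def, HeckeZero.gen, heckeRep]

/-- A `k`-linear map that commutes with all `π̄_i` is `H_n(0)`-linear. -/
theorem map_hecke_smul {D' : Finset (ℕ × ℕ)} (f : TabModule k n D →ₗ[k] TabModule k n D')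
    (hf : ∀ i x, f (piBar k i x) = piBar k i (f x)) (h : HeckeZero k n) (x : TabModule k n D) :
    f (h • x) = h • f x := by
  obtain ⟨a, rfl⟩ := RingQuot.mkAlgHom_surjective k (HeckeRel k n) h
  induction a using FreeAlgebra.induction generalizing x with
  | grade0 c => simp [HeckeZero.smul_def, Module.algebraMap_end_apply]
  | grade1 i =>
    change f (HeckeZero.gen k i • x) = HeckeZero.gen k i • f x
    rw [HeckeZero.gen_smul, HeckeZero.gen_smul, map_add, hf]
  | mul a b ha hb => rw [map_mul, mul_smul, mul_smul, ha, hb]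
  | add a b ha hb => rw [map_add, add_smul, add_smul, map_add, ha, hb]

end Relations

/-! ### The gluing maps -/

/-- Translate the cells above row `R` one unit down. -/
def shiftDown (R : ℕ) (x : ℕ × ℕ) : ℕ × ℕ := if x.1 ≤ R then x else (x.1 - 1, x.2)

section Gluing

variable (k : Type u) [Field k] {n : ℕ}

open Classical in
/-- The gluing operation, as a `k`-linear map: a tableau `T` of shape `D` is sent to the filling
`T↓` obtained by translating the part of `T` above row `R` one unit down with its entries,
if `T↓` is a standard tableau of shape `D'`, and to `0` otherwise. -/
def glueLin (D D' : Finset (ℕ × ℕ)) (R : ℕ) : TabModule k n D →ₗ[k] TabModule k n D' :=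
  TabModule.lift k fun T =>
    if h : ∃ T' : StdTableau D' n, ∀ e, T'.pos e = shiftDown R (T.pos e)
    then TabModule.basisVec k h.choose
    else 0

theorem glueLin_of_pos {D D' : Finset (ℕ × ℕ)} {R : ℕ} {T : StdTableau D n}
    {T' : StdTableau D' n} (h : ∀ e, T'.pos e = shiftDown R (T.pos e)) :
    glueLin k D D' R (TabModule.basisVec k T) = TabModule.basisVec k T' := by
  have h' : ∃ T' : StdTableau D' n, ∀ e, T'.pos e = shiftDown R (T.pos e) := ⟨T', h⟩
  rw [glueLin, TabModule.lift_basisVec, dif_pos h']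
  congr 1
  exact StdTableau.ext_pos fun e => (h'.choose_spec e).trans (h e).symm

theorem glueLin_of_not {D D' : Finset (ℕ × ℕ)} {R : ℕ} {T : StdTableau D n}
    (h : ¬ ∃ T' : StdTableau D' n, ∀ e, T'.pos e = shiftDown R (T.pos e)) :
    glueLin k D D' R (TabModule.basisVec k T) = 0 := by
  rw [glueLin, TabModule.lift_basisVec, dif_neg h]

/-- The cells in each row are consecutive. -/
def RowConvex (D : Finset (ℕ × ℕ)) : Prop :=
  ∀ r a b c : ℕ, (r, a) ∈ D → (r, c) ∈ D → a ≤ b → b ≤ c → (r, b) ∈ D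

/-- All cells above row `R` lie strictly to the right of the other cells. -/
def SplitsAt (D : Finset (ℕ × ℕ)) (R : ℕ) : Prop :=
  ∀ x ∈ D, ∀ y ∈ D, x.1 ≤ R → R < y.1 → x.2 < y.2

theorem StdTableau.lt_of_row_eq {D : Finset (ℕ × ℕ)} (hD : RowConvex D) (T : StdTableau D n)
    (e f : Fin n) (hr : T.row e = T.row f) (hc : (T.pos e).2 < (T.pos f).2) : e < f := by
  obtain ⟨d, hd⟩ := Nat.exists_eq_add_of_lt hc
  induction d generalizing f with
  | zero =>
    refine T.horiz_pos e f (Prod.ext hr.symm hd)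
  | succ d ih =>
    have hm : (T.row f, (T.pos e).2 + d + 1) ∈ D := by
      refine hD _ (T.pos e).2 _ (T.pos f).2 ?_ (T.pos_mem f) (by omega) (by omega)
      rw [← hr]
      exact T.pos_mem e
    have hg := T.pos_fill ⟨_, hm⟩
    set g := T.fill ⟨_, hm⟩
    have h1 : e < g := ih g (by rw [hr]; exact (congrArg Prod.fst hg).symm) (by rw [hg]; simp only; omega)
      (by rw [hg])
    refine h1.trans (T.horiz_pos g f ?_)
    rw [hg]
    exact Prod.ext rfl hd

theorem glueLin_piBar {D D' : Finset (ℕ × ℕ)} {R : ℕ} (hD : SplitsAt D R) (hD' : RowConvex D')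
    (i : Fin (n - 1)) (x : TabModule k n D) :
    glueLin k D D' R (piBar k i x) = piBar k i (glueLin k D D' R x) := by
  suffices (glueLin k D D' R).comp (piBar k i) = (piBar k i).comp (glueLin k D D' R) from
    LinearMap.congr_fun this x
  refine TabModule.hom_ext k fun T => ?_
  simp only [LinearMap.comp_apply]
  have hlh := lo_lt_hi i
  have s2 : ∀ x : ℕ × ℕ, (shiftDown R x).2 = x.2 := fun x => by
    unfold shiftDown; split_ifs <;> rfl
  have s1 : ∀ x : ℕ × ℕ, (shiftDown R x).1 = if x.1 ≤ R then x.1 else x.1 - 1 := fun x => by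
    unfold shiftDown; split_ifs <;> rfl
  have hA := hD _ (T.pos_mem (lo i)) _ (T.pos_mem (hi i))
  have hB := hD _ (T.pos_mem (hi i)) _ (T.pos_mem (lo i))
  change T.row (lo i) ≤ R → R < T.row (hi i) → _ at hA
  change T.row (hi i) ≤ R → R < T.row (lo i) → _ at hB
  have hlo : (shiftDown R (T.pos (lo i))).1 =
      if T.row (lo i) ≤ R then T.row (lo i) else T.row (lo i) - 1 := s1 _
  have hhi : (shiftDown R (T.pos (hi i))).1 =
      if T.row (hi i) ≤ R then T.row (hi i) else T.row (hi i) - 1 := s1 _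
  rcases lt_trichotomy (T.row (lo i)) (T.row (hi i)) with h | h | h
  · rw [piBar_of_lt k i h]
    have hsw := T.pos_swapEntries i h
    by_cases hf : (shiftDown R (T.pos (lo i))).1 = (shiftDown R (T.pos (hi i))).1
    · have hc : (T.pos (lo i)).2 < (T.pos (hi i)).2 := by
        rw [hlo, hhi] at hf
        apply hA <;> split_ifs at hf <;> omega
      rw [glueLin_of_not]
      · by_cases hT : ∃ T' : StdTableau D' n, ∀ e, T'.pos e = shiftDown R (T.pos e)
        · obtain ⟨T', hT'⟩ := hT
          rw [glueLin_of_pos k hT', piBar_of_eq]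
          simpa [StdTableau.row, hT'] using hf
        · rw [glueLin_of_not k hT, map_zero]
      · rintro ⟨T', hT'⟩
        have := T'.lt_of_row_eq hD' (hi i) (lo i)
          (by simpa [StdTableau.row, hT', hsw] using hf)
          (by simpa [hT', hsw, s2] using hc)
        exact absurd this hlh.not_gt
    · have hf' : (shiftDown R (T.pos (lo i))).1 < (shiftDown R (T.pos (hi i))).1 := by
        rw [hlo, hhi] at hf ⊢
        split_ifs at hf ⊢ <;> omega
      by_cases hT : ∃ T' : StdTableau D' n, ∀ e, T'.pos e = shiftDown R (T.pos e)
      · obtain ⟨T', hT'⟩ := hT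
        have hr : T'.row (lo i) < T'.row (hi i) := by simpa [StdTableau.row, hT'] using hf'
        rw [glueLin_of_pos k hT', piBar_of_lt k i hr]
        apply glueLin_of_pos
        intro e
        rw [T'.pos_swapEntries, hT', hsw]
      · rw [glueLin_of_not k hT, map_zero, glueLin_of_not]
        rintro ⟨T', hT'⟩
        apply hT
        have pl : T'.pos (lo i) = shiftDown R (T.pos (hi i)) := by simp [hT', hsw]
        have ph : T'.pos (hi i) = shiftDown R (T.pos (lo i)) := by simp [hT', hsw]
        refine ⟨T'.interchange i ?_ ?_, fun e => ?_⟩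
        · intro hh
          rw [pl, ph] at hh
          have := congrArg Prod.fst hh
          simp only at this
          omega
        · intro hv
          rw [pl, ph] at hv
          have e1 := congrArg Prod.fst hv
          have e2 := congrArg Prod.snd hv
          simp only [s2] at e1 e2
          by_cases hs : T.row (lo i) ≤ R ∧ R < T.row (hi i)
          · have := hA hs.1 hs.2
            omega
          · have e3 : T.row (hi i) = T.row (lo i) + 1 := by
              rw [hlo, hhi] at e1
              split_ifs at e1 <;> omega
            have := T.vert_pos (hi i) (lo i) (Prod.ext e3 e2)
            exact absurd this hlh.not_gt
        · rw [T'.pos_interchange, hT', hsw, Equiv.swap_apply_self]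
  · rw [piBar_of_eq k i h, map_zero]
    by_cases hT : ∃ T' : StdTableau D' n, ∀ e, T'.pos e = shiftDown R (T.pos e)
    · obtain ⟨T', hT'⟩ := hT
      rw [glueLin_of_pos k hT', piBar_of_eq]
      rw [StdTableau.row, StdTableau.row, hT', hT', hlo, hhi, h]
    · rw [glueLin_of_not k hT, map_zero]
  · rw [piBar_of_gt k i h, map_neg]
    by_cases hT : ∃ T' : StdTableau D' n, ∀ e, T'.pos e = shiftDown R (T.pos e)
    · obtain ⟨T', hT'⟩ := hT
      rw [glueLin_of_pos k hT', piBar_of_gt]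
      by_contra hle
      have hf : (shiftDown R (T.pos (lo i))).1 = (shiftDown R (T.pos (hi i))).1 := by
        rw [StdTableau.row, StdTableau.row, hT', hT', hlo, hhi] at hle
        rw [hlo, hhi]
        split_ifs at hle ⊢ <;> omega
      have hc : (T.pos (hi i)).2 < (T.pos (lo i)).2 := by
        rw [hlo, hhi] at hf
        apply hB <;> split_ifs at hf <;> omega
      have := T'.lt_of_row_eq hD' (hi i) (lo i)
        (by simpa [StdTableau.row, hT'] using hf.symm) (by simpa [hT', s2] using hc)
      exact absurd this hlh.not_gt
    · rw [glueLin_of_not k hT, map_zero, neg_zero]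

end Gluing

section Structure

theorem length_le_size (β : Comp) : β.length ≤ Comp.size β := by
  induction β with
  | nil => simp [Comp.size]
  | cons b β ihb =>
    have := b.pos
    simp only [Comp.size, List.map_cons, List.sum_cons, List.length_cons] at *
    omega

theorem ribbonCells_bounds (α : Comp) (r c : ℕ) :
    ∀ x ∈ ribbonCells r c α, r ≤ x.1 ∧ x.1 < r + α.length ∧ c ≤ x.2 ∧
      x.2 + α.length ≤ c + α.size := by
  induction α generalizing r c with
  | nil => simp [ribbonCells]
  | cons a α ih =>
    intro x hx
    have ha := a.pos
    have hl := length_le_size α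
    have hsz : Comp.size (a :: α) = a + Comp.size α := by simp [Comp.size]
    rw [hsz]
    simp only [ribbonCells, List.mem_append, List.mem_map, List.mem_range] at hx
    rcases hx with ⟨t, ht, rfl⟩ | hx
    · simp only [List.length_cons]
      omega
    · have := ih _ _ x hx
      simp only [List.length_cons]
      omega

theorem seqCells_bounds (α : List Comp) (r c : ℕ) :
    ∀ x ∈ seqCells r c α, r ≤ x.1 ∧ c ≤ x.2 := by
  induction α generalizing r c with
  | nil => simp [seqCells]
  | cons a α ih =>
    intro x hx
    have hl := length_le_size a
    simp only [seqCells, List.mem_append] at hx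
    rcases hx with hx | hx
    · have := ribbonCells_bounds a r c x hx
      omega
    · have := ih _ _ x hx
      omega

theorem ribbonCells_convex (α : Comp) (r₀ c₀ r x y z : ℕ) (hx : (r, x) ∈ ribbonCells r₀ c₀ α)
    (hz : (r, z) ∈ ribbonCells r₀ c₀ α) (hxy : x ≤ y) (hyz : y ≤ z) :
    (r, y) ∈ ribbonCells r₀ c₀ α := by
  induction α generalizing r₀ c₀ with
  | nil => simp [ribbonCells] at hx
  | cons a α ih =>
    simp only [ribbonCells, List.mem_append, List.mem_map, List.mem_range, Prod.mk.injEq] at *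
    rcases hx with ⟨t, ht, h1, h2⟩ | hx
    · rcases hz with ⟨t', ht', h3, h4⟩ | hz
      · exact Or.inl ⟨y - c₀, by omega, h1, by omega⟩
      · have := ribbonCells_bounds _ _ _ _ hz
        simp only at this
        omega
    · rcases hz with ⟨t', ht', h3, h4⟩ | hz
      · have := ribbonCells_bounds _ _ _ _ hx
        simp only at this
        omega
      · exact Or.inr (ih _ _ hx hz)

theorem seqCells_convex (α : List Comp) (r₀ c₀ r x y z : ℕ) (hx : (r, x) ∈ seqCells r₀ c₀ α)
    (hz : (r, z) ∈ seqCells r₀ c₀ α) (hxy : x ≤ y) (hyz : y ≤ z) :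
    (r, y) ∈ seqCells r₀ c₀ α := by
  induction α generalizing r₀ c₀ with
  | nil => simp [seqCells] at hx
  | cons a α ih =>
    simp only [seqCells, List.mem_append] at *
    rcases hx with hx | hx
    · rcases hz with hz | hz
      · exact Or.inl (ribbonCells_convex a _ _ _ _ _ _ hx hz hxy hyz)
      · have := ribbonCells_bounds _ _ _ _ hx
        have := seqCells_bounds _ _ _ _ hz
        simp only at *
        omega
    · rcases hz with hz | hz
      · have := ribbonCells_bounds _ _ _ _ hz
        have := seqCells_bounds _ _ _ _ hx
        simp only at *
        omega
      · exact Or.inr (ih _ _ hx hz)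

theorem rowConvex_diag (α : List Comp) : RowConvex (diag α) := by
  intro r a b c ha hc hab hbc
  simp only [diag, List.mem_toFinset] at *
  exact seqCells_convex α 1 1 r a b c ha hc hab hbc

theorem seqCells_splits (α β : List Comp) (r c : ℕ) (x y : ℕ × ℕ)
    (hx : x ∈ seqCells r c (α ++ β)) (hy : y ∈ seqCells r c (α ++ β))
    (hxr : x.1 < r + numRows α) (hyr : r + numRows α ≤ y.1) : x.2 < y.2 := by
  induction α generalizing r c with
  | nil =>
    have := seqCells_bounds _ _ _ _ hx
    simp [numRows] at hxr
    omega
  | cons a α ih =>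
    have hl := length_le_size a
    simp only [List.cons_append, seqCells, List.mem_append] at hx hy
    have hn : numRows (a :: α) = a.length + numRows α := by simp [numRows]
    rw [hn] at hxr hyr
    rcases hy with hy | hy
    · have := ribbonCells_bounds _ _ _ _ hy
      omega
    · rcases hx with hx | hx
      · have := ribbonCells_bounds _ _ _ _ hx
        have := seqCells_bounds _ _ _ _ hy
        omega
      · exact ih _ _ hx hy (by omega) (by omega)

theorem glueFrom_ne_nil (I : Finset ℕ) (i : ℕ) (a : Comp) (α : List Comp) :
    glueFrom I i (a :: α) ≠ [] := by
  rw [glueFrom]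
  split
  · simp
  · split_ifs <;> simp

/-- If the `j`-th comma is kept, the sequence `α⃗(I)` splits there. -/
theorem glueFrom_append (I : Finset ℕ) (i m : ℕ) (α : List Comp) (hI : i + m ∉ I) :
    ∃ β, glueFrom I i α = glueFrom I i (α.take (m + 1)) ++ β := by
  induction α generalizing i m with
  | nil => exact ⟨[], by simp [glueFrom]⟩
  | cons a α ih =>
    cases m with
    | zero =>
      simp only [zero_add, List.take_succ_cons, List.take_zero]
      rw [glueFrom, glueFrom, glueFrom]
      split
      · exact ⟨[], by simp⟩
      · rename_i b β _
        exact ⟨b :: β, by simpa using hI⟩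
    | succ m =>
      obtain ⟨β, hβ⟩ := ih (i + 1) m (by rwa [add_right_comm, add_assoc])
      rw [List.take_succ_cons, glueFrom, glueFrom, hβ]
      cases α with
      | nil =>
        refine ⟨[], ?_⟩
        have : β = [] := by simpa [glueFrom] using hβ.symm
        subst this
        simp [glueFrom]
      | cons a' α =>
        rw [List.take_succ_cons] at *
        rcases hg : glueFrom I (i + 1) (a' :: α.take m) with _ | ⟨b, γ⟩
        · exact absurd hg (glueFrom_ne_nil _ _ _ _)
        · refine ⟨β, ?_⟩
          simp only [List.cons_append]
          split_ifs <;> simp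

end Structure

/-- The number of rows of `Diag(α⃗(I))` that belong to the components to the left of the `j`-th
comma of `α⃗`, that is, to those formed from `α⁽¹⁾, …, α⁽ʲ⁾`. -/
def rowsBelow (α : List Comp) (I : Finset ℕ) (j : ℕ) : ℕ := numRows (glueAt I (α.take j))

theorem splitsAt_diag_glueAt (α : List Comp) (I : Finset ℕ) (j : ℕ) (hj : 1 ≤ j) (hI : j ∉ I) :
    SplitsAt (diag (glueAt I α)) (rowsBelow α I j) := by
  obtain ⟨m, rfl⟩ := Nat.exists_eq_add_of_le hj
  obtain ⟨β, hβ⟩ := glueFrom_append I 1 m α hI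
  intro x hx y hy h1 h2
  rw [add_comm 1 m] at h1 h2
  simp only [diag, glueAt, List.mem_toFinset, hβ, rowsBelow] at *
  exact seqCells_splits _ β 1 1 x y hx hy (by omega) (by omega)

/-! ### The complex -/

section Complex

variable (k : Type u) [Field k] (n : ℕ)

/-- The `H_n(0)`-module `P_{β⃗}` of a sequence `β⃗` of compositions of total size `n`. -/
abbrev P (β : List Comp) : Type u := TabModule k n (diag β)

/-- The gluing map `φ_j : P_{α⃗(I)} → P_{α⃗(I ∪ {j})}` at the `j`-th comma of `α⃗`: the cells that
come from `α⁽ʲ⁺¹⁾, …, α⁽ˡ⁾` are translated one unit down. -/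
def phi (α : List Comp) (I : Finset ℕ) (j : ℕ) (hj : 1 ≤ j) (hI : j ∉ I) :
    P k n (glueAt I α) →ₗ[HeckeZero k n] P k n (glueAt (insert j I) α) where
  toFun := glueLin k (diag (glueAt I α)) (diag (glueAt (insert j I) α)) (rowsBelow α I j)
  map_add' := map_add _
  map_smul' := map_hecke_smul k _
    (glueLin_piBar k (splitsAt_diag_glueAt α I j hj hI) (rowConvex_diag _))

/-- The sets `I ⊆ {1, …, ℓ - 1}` with `i` elements. -/
abbrev CommaSets (α : List Comp) (i : ℕ) : Type :=
  {I : Finset ℕ // I ∈ (Finset.Icc 1 (α.length - 1)).powersetCard i}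

/-- The elements of `{1, …, ℓ - 1} \ I`. -/
abbrev FreeCommas (α : List Comp) (I : Finset ℕ) : Type :=
  {j : ℕ // j ∈ Finset.Icc 1 (α.length - 1) \ I}

theorem FreeCommas.one_le {α : List Comp} {I : Finset ℕ} (j : FreeCommas α I) : 1 ≤ j.1 :=
  (Finset.mem_Icc.1 (Finset.mem_sdiff.1 j.2).1).1

theorem FreeCommas.notMem {α : List Comp} {I : Finset ℕ} (j : FreeCommas α I) : j.1 ∉ I :=
  (Finset.mem_sdiff.1 j.2).2

/-- The set `I ∪ {j}`. -/
def CommaSets.insert {α : List Comp} {i : ℕ} (I : CommaSets α i) (j : FreeCommas α I.1) :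
    CommaSets α (i + 1) :=
  ⟨Insert.insert j.1 I.1, by
    have hI := Finset.mem_powersetCard.1 I.2
    have hj := Finset.mem_sdiff.1 j.2
    rw [Finset.mem_powersetCard, Finset.card_insert_of_notMem hj.2, hI.2]
    exact ⟨Finset.insert_subset hj.1 hI.1, rfl⟩⟩

/-- The term `C_i(α⃗) = ⨁_{|I| = i} P_{α⃗(I)}`. -/
abbrev Term (α : List Comp) (i : ℕ) : Type u :=
  DirectSum (CommaSets α i) fun I => P k n (glueAt I.1 α)

/-- The sign `sgn(j, I) = (-1)^{#{t ∈ I : t < j}}`. -/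
def sgn (j : ℕ) (I : Finset ℕ) : ℤ := (-1) ^ (I.filter (· < j)).card

/-- The differential `∂_i : C_i(α⃗) → C_{i+1}(α⃗)`, which sends `T ∈ P_{α⃗(I)}` to
`∑_{j ∉ I} sgn(j, I) φ_j(T)`. -/
def differential (α : List Comp) (i : ℕ) :
    Term k n α i →ₗ[HeckeZero k n] Term k n α (i + 1) :=
  DirectSum.toModule (HeckeZero k n) (CommaSets α i) (Term k n α (i + 1)) fun I =>
    ∑ j : FreeCommas α I.1, sgn j.1 I.1 •
      (DirectSum.lof (HeckeZero k n) (CommaSets α (i + 1)) (fun J => P k n (glueAt J.1 α))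
        (I.insert j)).comp (phi k n α I.1 j.1 j.one_le j.notMem)

/-- The term `C_i(α⃗)` as an object of the category of `H_n(0)`-modules. -/
abbrev termObj (α : List Comp) (i : ℕ) : ModuleCat.{u} (HeckeZero k n) :=
  ModuleCat.of (HeckeZero k n) (Term k n α i)

/-- The differential as a morphism in the category of `H_n(0)`-modules. -/
abbrev differentialHom (α : List Comp) (i : ℕ) : termObj k n α i ⟶ termObj k n α (i + 1) :=
  ModuleCat.ofHom (differential k n α i)

end Complex

end RibbonHecke

end

/-! Listing the cells of a generalized ribbon from southwest to northeast turns a tableau into its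
reading word, a permutation `w`. Gluing at a comma only changes the displacement at that comma from
diagonal to horizontal, and adjacent cells are always consecutive in the list. So `w` is standard
for α⃗(I) exactly when it satisfies the conditions inside the components and ascends at every comma
in I (`isStd_glue_iff`), and φ_j preserves the reading word of every tableau that it does not kill
(`coef_phi`).

As a complex of vector spaces, C(α⃗) therefore splits into a direct sum over the words `w` that
satisfy the conditions inside the components. The summand of `w` has as basis the subsets I of its
set A of ascending commas, and the differential adds one element of A at a time with the usual sign:
up to a shift, this is the augmented cochain complex of the full simplex on A. If A is nonempty it
is contractible, by removal of min A (`exists_differential_eq`). If A is empty, only I = ∅ in degree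
0 is left. That ∂² = 0 is the usual sign cancellation (`sum_sgn_mul_sgn`).

Hence H⁰ is spanned by the words that descend at every comma. These are the reading words for the
concatenation, where each comma becomes a step up (`isStd_flat_iff`). A diagonal step and a step up
climb the same number of rows, and π̄_i only compares rows, so this identification is H_n(0)-linear
(`transfer_piBar`). -/

noncomputable section

namespace RibbonHecke

/-! ### Reading a generalized ribbon from southwest to northeast -/

/-- The steps between consecutive cells of a generalized ribbon: a step to the right or upwards
inside a component, or the step across the `j`-th comma. -/
inductive StepLabel : Type
  | right
  | up
  | comma (j : ℕ)

/-- The displacement of a step, where `s j` is the displacement at the `j`-th comma. -/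
def StepLabel.disp (s : ℕ → ℕ × ℕ) : StepLabel → ℕ × ℕ
  | right => (0, 1)
  | up => (1, 0)
  | comma j => s j

/-- The steps in the ribbon of a composition. -/
def compLabels : Comp → List StepLabel
  | [] => []
  | [a] => List.replicate ((a : ℕ) - 1) .right
  | a :: b :: α => List.replicate ((a : ℕ) - 1) .right ++ .up :: compLabels (b :: α)

/-- The steps in the generalized ribbon of a sequence of compositions, whose first comma has the
number `i`. -/
def seqLabels : ℕ → List Comp → List StepLabel
  | _, [] => []
  | _, [a] => compLabels a
  | i, a :: b :: α => compLabels a ++ .comma i :: seqLabels (i + 1) (b :: α)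

/-- The cells visited from `x` by a sequence of steps. -/
def walk : ℕ × ℕ → List (ℕ × ℕ) → List (ℕ × ℕ)
  | x, [] => [x]
  | x, s :: S => x :: walk (x + s) S

theorem mem_walk (x y : ℕ × ℕ) (S : List (ℕ × ℕ)) :
    y ∈ walk x S ↔ ∃ p, p < S.length + 1 ∧ x + (S.take p).sum = y := by
  induction S generalizing x with
  | nil =>
    simp only [walk, List.mem_singleton]
    constructor
    · rintro rfl
      exact ⟨0, by simp⟩
    · rintro ⟨p, -, rfl⟩
      simp
  | cons s S ih =>
    rw [walk, List.mem_cons, ih]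
    constructor
    · rintro (rfl | ⟨p, hp, rfl⟩)
      · exact ⟨0, by simp⟩
      · exact ⟨p + 1, by simpa using hp, by simp [add_assoc]⟩
    · rintro ⟨p, hp, rfl⟩
      cases p with
      | zero => simp
      | succ p => exact Or.inr ⟨p, by simpa using hp, by simp [add_assoc]⟩

theorem walk_append_cons (x s : ℕ × ℕ) (S S' : List (ℕ × ℕ)) :
    walk x (S ++ s :: S') = walk x S ++ walk (x + S.sum + s) S' := by
  induction S generalizing x with
  | nil => simp [walk]
  | cons t S ih => simp [walk, ih, add_assoc]

theorem walk_replicate (r c m : ℕ) :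
    walk (r, c) (List.replicate m (0, 1)) = (List.range (m + 1)).map fun t => (r, c + t) := by
  induction m generalizing c with
  | zero => simp [walk]
  | succ m ih =>
    rw [List.replicate_succ, walk, List.range_succ_eq_map, Prod.mk_add_mk, add_zero, ih]
    simp [Function.comp_def, add_assoc, add_comm 1]

theorem ribbonCells_eq_walk (s : ℕ → ℕ × ℕ) (r c : ℕ) (α : Comp) (hα : α ≠ []) :
    ribbonCells r c α = walk (r, c) ((compLabels α).map (StepLabel.disp s)) := by
  induction α generalizing r c with
  | nil => exact absurd rfl hα
  | cons a α ih =>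
    have ha := a.pos
    have ha' : (a : ℕ) - 1 + 1 = a := by omega
    cases α with
    | nil => simp [ribbonCells, compLabels, StepLabel.disp, walk_replicate, ha']
    | cons b α =>
      rw [ribbonCells, ih _ _ (by simp), compLabels]
      simp only [List.map_append, List.map_replicate, List.map_cons, StepLabel.disp,
        walk_append_cons, walk_replicate, ha', List.sum_replicate]
      congr 2
      ext <;> simp
      omega

/-- The summand `(1, 1)` is the step across the following comma, so the right-hand side is the
offset by which `seqCells` places the next component. -/
theorem sum_compLabels (s : ℕ → ℕ × ℕ) (α : Comp) (hα : α ≠ []) :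
    ((compLabels α).map (StepLabel.disp s)).sum + (1, 1) =
      (α.length, Comp.size α - α.length + 1) := by
  induction α with
  | nil => exact absurd rfl hα
  | cons a α ih =>
    have ha := a.pos
    cases α with
    | nil =>
      ext <;> simp [compLabels, StepLabel.disp, Comp.size]
    | cons b α =>
      have ih := ih (by simp)
      have hl := length_le_size (b :: α)
      have hsz : Comp.size (a :: b :: α) = a + Comp.size (b :: α) := by simp [Comp.size]
      simp only [compLabels, List.map_append, List.map_replicate, List.map_cons, StepLabel.disp,
        List.sum_append, List.sum_cons, List.sum_replicate, add_assoc, ih, hsz]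
      ext
      · simp; omega
      · simp only [Prod.snd_add, Prod.smul_snd, List.length_cons, smul_eq_mul, mul_one] at *
        omega

theorem seqCells_eq_walk (i r c : ℕ) (α : List Comp) (hα : ∀ a ∈ α, a ≠ []) (hne : α ≠ []) :
    seqCells r c α = walk (r, c) ((seqLabels i α).map (StepLabel.disp fun _ => (1, 1))) := by
  induction α generalizing i r c with
  | nil => exact absurd rfl hne
  | cons a α ih =>
    have ha : a ≠ [] := hα a (by simp)
    cases α with
    | nil => simp [seqCells, seqLabels, ribbonCells_eq_walk (fun _ => (1, 1)) r c a ha]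
    | cons b α =>
      have hl := length_le_size a
      rw [seqCells, seqLabels, ih (i + 1) _ _ (fun x hx => hα x (List.mem_cons_of_mem _ hx))
        (by simp), ribbonCells_eq_walk (fun _ => (1, 1)) r c a ha]
      simp only [List.map_append, List.map_cons, StepLabel.disp, walk_append_cons]
      rw [add_assoc, sum_compLabels _ a ha]
      congr 2
      ext <;> simp
      omega

/-! ### Effect of gluing and of concatenation on the steps -/

/-- The displacement at the commas when the commas in `I` are replaced by `⊙`. -/
def glueDisp (I : Finset ℕ) (j : ℕ) : ℕ × ℕ := if j ∈ I then (0, 1) else (1, 1)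

theorem nearConcat_ne_nil (a b : Comp) (ha : a ≠ []) : nearConcat a b ≠ [] := by
  match a, b with
  | [], _ => exact absurd rfl ha
  | [a], [] => simp [nearConcat]
  | [a], b :: β => simp [nearConcat]
  | a :: a' :: α, β => simp [nearConcat]

theorem compLabels_nearConcat (a b : Comp) (ha : a ≠ []) (hb : b ≠ []) :
    compLabels (nearConcat a b) = compLabels a ++ .right :: compLabels b := by
  induction a with
  | nil => exact absurd rfl ha
  | cons x a ih =>
    cases a with
    | nil =>
      obtain ⟨y, b, rfl⟩ := List.exists_cons_of_ne_nil hb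
      have hx := x.pos
      have hy := y.pos
      -- The merged row has x + y - 1 steps to the right: those of the last row of `a`, the joining
      -- step, and those of the first row of `b`.
      have e : ((x + y : ℕ+) : ℕ) - 1 = (x - 1) + ((y - 1) + 1) := by
        rw [PNat.add_coe]; omega
      cases b <;> simp only [nearConcat, compLabels, e, List.replicate_add] <;>
        simp [List.replicate_succ, ← List.replicate_succ']
    | cons x' a =>
      have ih := ih (by simp)
      obtain ⟨y, z, hz⟩ := List.exists_cons_of_ne_nil
        (nearConcat_ne_nil (x' :: a) b (by simp))
      rw [nearConcat, hz, compLabels, ← hz, ih, compLabels]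
      simp

theorem compLabels_append (a b : Comp) (ha : a ≠ []) (hb : b ≠ []) :
    compLabels (a ++ b) = compLabels a ++ .up :: compLabels b := by
  induction a with
  | nil => exact absurd rfl ha
  | cons x a ih =>
    cases a with
    | nil =>
      obtain ⟨y, b, rfl⟩ := List.exists_cons_of_ne_nil hb
      simp [compLabels]
    | cons x' a =>
      have ih := ih (by simp)
      simp only [List.cons_append, compLabels] at *
      simp [ih]

theorem glueFrom_mem_ne_nil (I : Finset ℕ) (i : ℕ) (α : List Comp) (hα : ∀ a ∈ α, a ≠ []) :
    ∀ a ∈ glueFrom I i α, a ≠ [] := by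
  induction α generalizing i with
  | nil => simp [glueFrom]
  | cons a α ih =>
    have ha : a ≠ [] := hα a (by simp)
    have ih := ih (i + 1) (fun x hx => hα x (List.mem_cons_of_mem _ hx))
    rw [glueFrom]
    split
    · simpa using ha
    · rename_i b β h
      rw [h] at ih
      split_ifs
      · intro x hx
        rcases List.mem_cons.1 hx with rfl | hx
        · exact nearConcat_ne_nil _ _ ha
        · exact ih x (by simp [hx])
      · intro x hx
        rcases List.mem_cons.1 hx with rfl | hx
        · exact ha
        · exact ih x hx

theorem map_disp_compLabels (s t : ℕ → ℕ × ℕ) (a : Comp) :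
    (compLabels a).map (StepLabel.disp s) = (compLabels a).map (StepLabel.disp t) := by
  induction a with
  | nil => rfl
  | cons x a ih => cases a <;> simp_all [compLabels, StepLabel.disp]

/-- This is what allows all the shapes α⃗(I) to share one list of steps: the labels stay those of
α⃗, and I only enters through the displacement at the commas. The starting number `i'` is arbitrary
because the displacement on the left ignores comma numbers. -/
theorem map_disp_glueFrom (I : Finset ℕ) (i i' : ℕ) (α : List Comp) (hα : ∀ a ∈ α, a ≠ []) :
    (seqLabels i' (glueFrom I i α)).map (StepLabel.disp fun _ => (1, 1)) =
      (seqLabels i α).map (StepLabel.disp (glueDisp I)) := by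
  induction α generalizing i i' with
  | nil => simp [glueFrom, seqLabels]
  | cons a α ih =>
    have ha : a ≠ [] := hα a (by simp)
    have hα' : ∀ x ∈ α, x ≠ [] := fun x hx => hα x (List.mem_cons_of_mem _ hx)
    have hm := map_disp_compLabels (fun _ => (1, 1)) (glueDisp I) a
    cases α with
    | nil => simpa [glueFrom, seqLabels] using hm
    | cons a' α =>
      have hne := glueFrom_mem_ne_nil I (i + 1) _ hα'
      rw [glueFrom]
      rcases hg : glueFrom I (i + 1) (a' :: α) with _ | ⟨b, β⟩
      · exact absurd hg (glueFrom_ne_nil _ _ _ _)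
      rw [hg] at hne
      simp only
      split_ifs with hi
      · have hb : b ≠ [] := hne b (by simp)
        have ih := ih (i + 1) i' hα'
        rw [hg] at ih
        simp only [seqLabels, List.map_append, List.map_cons, ← ih, ← hm]
        cases β <;> simp [seqLabels, compLabels_nearConcat a b ha hb, StepLabel.disp, glueDisp, hi]
      · have ih := ih (i + 1) (i' + 1) hα'
        rw [hg] at ih
        simp [seqLabels, ← ih, ← hm, StepLabel.disp, glueDisp, hi]

/-- Concatenation joins neighbouring components by a step up. The displacement `s` is arbitrary
because a single ribbon has no commas. -/
theorem map_disp_flatten (s : ℕ → ℕ × ℕ) (i : ℕ) (α : List Comp) (hα : ∀ a ∈ α, a ≠ []) :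
    (compLabels α.flatten).map (StepLabel.disp s) =
      (seqLabels i α).map (StepLabel.disp fun _ => (1, 0)) := by
  induction α generalizing i with
  | nil => simp [compLabels, seqLabels]
  | cons a α ih =>
    have ha : a ≠ [] := hα a (by simp)
    have hα' : ∀ x ∈ α, x ≠ [] := fun x hx => hα x (List.mem_cons_of_mem _ hx)
    have hm := map_disp_compLabels s (fun _ => (1, 0)) a
    cases α with
    | nil => simpa [seqLabels] using hm
    | cons a' α =>
      rw [List.flatten_cons, compLabels_append _ _ ha, List.map_append, List.map_cons,
        ih (i + 1) hα', hm]
      · simp [seqLabels, StepLabel.disp]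
      · simpa using fun h => absurd h (hα' a' (by simp))

theorem length_compLabels (a : Comp) : (compLabels a).length = Comp.size a - 1 := by
  induction a with
  | nil => simp [compLabels, Comp.size]
  | cons x a ih =>
    have hx := x.pos
    cases a with
    | nil => simp [compLabels, Comp.size]
    | cons y a =>
      have hy := y.pos
      have h1 : Comp.size (x :: y :: a) = x + Comp.size (y :: a) := by simp [Comp.size]
      have h2 : Comp.size (y :: a) = y + Comp.size a := by simp [Comp.size]
      simp only [compLabels, List.length_append, List.length_replicate, List.length_cons, ih]
      omega

theorem Comp.size_pos {a : Comp} (ha : a ≠ []) : 0 < Comp.size a :=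
  (List.length_pos_of_ne_nil ha).trans_le (length_le_size a)

theorem length_seqLabels (i : ℕ) (α : List Comp) (hα : ∀ a ∈ α, a ≠ []) (hne : α ≠ []) :
    (seqLabels i α).length + 1 = seqSize α := by
  induction α generalizing i with
  | nil => exact absurd rfl hne
  | cons a α ih =>
    have ha := Comp.size_pos (hα a (by simp))
    have hα' : ∀ x ∈ α, x ≠ [] := fun x hx => hα x (List.mem_cons_of_mem _ hx)
    cases α with
    | nil => simp [seqLabels, seqSize, length_compLabels]; omega
    | cons b α =>
      have h1 : seqSize (a :: b :: α) = Comp.size a + seqSize (b :: α) := by simp [seqSize]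
      have := ih (i + 1) hα' (by simp)
      simp only [seqLabels, List.length_append, List.length_cons, length_compLabels]
      omega

/-- The path starts in the first row and never descends, so the number of rows is the total climb
plus one. -/
theorem numRows_eq (i : ℕ) (α : List Comp) (hα : ∀ a ∈ α, a ≠ []) (hne : α ≠ []) :
    numRows α = ((seqLabels i α).map (StepLabel.disp fun _ => (1, 1))).sum.1 + 1 := by
  induction α generalizing i with
  | nil => exact absurd rfl hne
  | cons a α ih =>
    have ha := congrArg Prod.fst (sum_compLabels (fun _ => (1, 1)) a (hα a (by simp)))
    have hα' : ∀ x ∈ α, x ≠ [] := fun x hx => hα x (List.mem_cons_of_mem _ hx)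
    simp only [Prod.fst_add] at ha
    have hn : numRows (a :: α) = a.length + numRows α := by simp [numRows]
    rw [hn]
    cases α with
    | nil => simp [seqLabels, numRows, ha]
    | cons b α =>
      have := ih (i + 1) hα' (by simp)
      simp only [seqLabels, List.map_append, List.sum_append, List.map_cons, List.sum_cons,
        Prod.fst_add, StepLabel.disp]
      omega

theorem comma_notMem_compLabels (j : ℕ) (a : Comp) : StepLabel.comma j ∉ compLabels a := by
  induction a with
  | nil => simp [compLabels]
  | cons x a ih => cases a <;> simp_all [compLabels, List.mem_replicate]

theorem comma_mem_seqLabels {i j : ℕ} {α : List Comp} (h : .comma j ∈ seqLabels i α) :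
    i ≤ j ∧ j + 1 < i + α.length := by
  induction α generalizing i with
  | nil => simp [seqLabels] at h
  | cons a α ih =>
    cases α with
    | nil => simp [seqLabels, comma_notMem_compLabels] at h
    | cons b α =>
      simp only [seqLabels, List.mem_append, comma_notMem_compLabels, false_or, List.mem_cons,
        StepLabel.comma.injEq] at h
      rcases h with rfl | h
      · simp
      · have := ih h
        simp only [List.length_cons] at *
        omega

theorem seqLabels_split (i m : ℕ) (α : List Comp) (hm : m + 1 < α.length) :
    seqLabels i α = seqLabels i (α.take (m + 1)) ++
      .comma (i + m) :: seqLabels (i + m + 1) (α.drop (m + 1)) := by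
  induction α generalizing i m with
  | nil => simp at hm
  | cons a α ih =>
    cases α with
    | nil => simp at hm
    | cons b α =>
      cases m with
      | zero => simp [seqLabels]
      | succ m =>
        rw [seqLabels, ih (i + 1) m (by simpa using hm)]
        simp [seqLabels, add_comm, add_left_comm]

/-- The label `comma j` occurs exactly once. -/
theorem exists_seqLabels_split (α : List Comp) {j : ℕ} (hj : j ∈ Finset.Icc 1 (α.length - 1)) :
    ∃ B, seqLabels 1 α = seqLabels 1 (α.take j) ++ .comma j :: B ∧
      .comma j ∉ seqLabels 1 (α.take j) ∧ .comma j ∉ B := by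
  rw [Finset.mem_Icc] at hj
  obtain ⟨m, rfl⟩ := Nat.exists_eq_add_of_le hj.1
  refine ⟨_, by rw [add_comm 1 m]; simpa [add_comm] using seqLabels_split 1 m α (by omega), ?_, ?_⟩
  · intro h
    have := comma_mem_seqLabels h
    simp only [List.length_take] at this
    omega
  · intro h
    have := comma_mem_seqLabels h
    omega

/-! ### Cells along the path -/

/-- The `p`-th cell of the path from `(1, 1)` along the steps of `α⃗`, where `s j` is the
displacement at the `j`-th comma. -/
def cellAt (s : ℕ → ℕ × ℕ) (α : List Comp) (p : ℕ) : ℕ × ℕ :=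
  (1, 1) + (((seqLabels 1 α).map (StepLabel.disp s)).take p).sum

section Cells

variable {s : ℕ → ℕ × ℕ} {α : List Comp}

theorem cellAt_succ {p : ℕ} {l : StepLabel} (h : (seqLabels 1 α)[p]? = some l) :
    cellAt s α (p + 1) = cellAt s α p + l.disp s := by
  have : ((seqLabels 1 α).map (StepLabel.disp s))[p]? = some (l.disp s) := by simp [h]
  rw [cellAt, cellAt, List.take_add_one, this]
  simp [add_assoc]

/-- Every step raises row plus column by at least 1. Hence the cells are distinct, and two cells
whose weights differ by 1 must be consecutive; a diagonal step has weight 2 and creates no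
adjacency. -/
theorem weight_cellAt (hs : ∀ j, 1 ≤ (s j).1 + (s j).2) {p d : ℕ}
    (h : p + d ≤ (seqLabels 1 α).length) :
    (cellAt s α p).1 + (cellAt s α p).2 + d ≤ (cellAt s α (p + d)).1 + (cellAt s α (p + d)).2 := by
  induction d with
  | zero => simp
  | succ d ih =>
    have hl := List.getElem?_eq_getElem (l := seqLabels 1 α) (i := p + d) (by omega)
    rw [← add_assoc p, cellAt_succ hl]
    have ih := ih (by omega)
    have : 1 ≤ (((seqLabels 1 α)[p + d]'(by omega)).disp s).1 +
        (((seqLabels 1 α)[p + d]'(by omega)).disp s).2 := by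
      generalize (seqLabels 1 α)[p + d]'_ = l
      cases l <;> simp [StepLabel.disp, hs]
    simp only [Prod.fst_add, Prod.snd_add]
    omega

/-- Adjacent cells are consecutive. -/
theorem cellAt_eq_add (hs : ∀ j, 1 ≤ (s j).1 + (s j).2) {p q : ℕ} {d : ℕ × ℕ}
    (hp : p ≤ (seqLabels 1 α).length) (hq : q ≤ (seqLabels 1 α).length) (hd : d.1 + d.2 = 1) :
    cellAt s α q = cellAt s α p + d ↔
      q = p + 1 ∧ ((seqLabels 1 α)[p]?).map (StepLabel.disp s) = some d := by
  constructor
  · intro h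
    have hw : (cellAt s α q).1 + (cellAt s α q).2 = (cellAt s α p).1 + (cellAt s α p).2 + 1 := by
      simp only [h, Prod.fst_add, Prod.snd_add]
      omega
    have hqp : q = p + 1 := by
      rcases le_total p q with hpq | hpq
      · obtain ⟨e, rfl⟩ := Nat.exists_eq_add_of_le hpq
        have := weight_cellAt (α := α) hs hq
        rcases e with _ | e
        · simp at hw
        · omega
      · obtain ⟨e, rfl⟩ := Nat.exists_eq_add_of_le hpq
        have := weight_cellAt (α := α) hs hp
        omega
    subst hqp
    have hl := List.getElem?_eq_getElem (l := seqLabels 1 α) (i := p) (by omega)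
    rw [cellAt_succ hl] at h
    exact ⟨rfl, by simpa [hl] using h⟩
  · rintro ⟨rfl, h⟩
    obtain ⟨l, hl, rfl⟩ := Option.map_eq_some_iff.1 h
    exact cellAt_succ hl

theorem cellAt_inj (hs : ∀ j, 1 ≤ (s j).1 + (s j).2) {p q : ℕ}
    (hp : p ≤ (seqLabels 1 α).length) (hq : q ≤ (seqLabels 1 α).length)
    (h : cellAt s α p = cellAt s α q) : p = q := by
  wlog hpq : p ≤ q generalizing p q
  · exact (this hq hp h.symm (le_of_not_ge hpq)).symm
  obtain ⟨e, rfl⟩ := Nat.exists_eq_add_of_le hpq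
  have := weight_cellAt (α := α) hs hq
  rw [h] at this
  omega

theorem glueDisp_weight (I : Finset ℕ) (j : ℕ) : 1 ≤ (glueDisp I j).1 + (glueDisp I j).2 := by
  unfold glueDisp; split_ifs <;> simp

theorem glueFrom_ne_nil_of_ne_nil (I : Finset ℕ) (i : ℕ) (hne : α ≠ []) :
    glueFrom I i α ≠ [] := by
  obtain ⟨a, α, rfl⟩ := List.exists_cons_of_ne_nil hne
  exact glueFrom_ne_nil I i a α

/-- Gluing at the `j`-th comma translates the cells after this comma one unit down. -/
theorem shiftDown_cellAt (hα : ∀ a ∈ α, a ≠ []) (I : Finset ℕ) {j : ℕ}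
    (hj : j ∈ Finset.Icc 1 (α.length - 1)) (hI : j ∉ I) (p : ℕ) :
    shiftDown (rowsBelow α I j) (cellAt (glueDisp I) α p) = cellAt (glueDisp (insert j I)) α p := by
  obtain ⟨B, hB, hjA, hjB⟩ := exists_seqLabels_split α hj
  have hj' := Finset.mem_Icc.1 hj
  have hα' : ∀ a ∈ α.take j, a ≠ [] := fun a ha => hα a (List.mem_of_mem_take ha)
  have hne : α.take j ≠ [] := by
    intro h
    have := congrArg List.length h
    simp only [List.length_take, List.length_nil] at this
    omega
  -- The threshold is the row of the last cell before the comma.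
  have hrows : rowsBelow α I j =
      ((seqLabels 1 (α.take j)).map (StepLabel.disp (glueDisp I))).sum.1 + 1 := by
    rw [rowsBelow, glueAt, numRows_eq 1 _ (glueFrom_mem_ne_nil _ _ _ hα')
      (glueFrom_ne_nil_of_ne_nil _ _ hne), map_disp_glueFrom I 1 1 _ hα']
  have hcongr : ∀ L : List StepLabel, .comma j ∉ L →
      L.map (StepLabel.disp (glueDisp (insert j I))) = L.map (StepLabel.disp (glueDisp I)) := by
    intro L hL
    refine List.map_congr_left fun l hl => ?_
    cases l with
    | right => rfl
    | up => rfl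
    | comma t =>
      have : t ≠ j := by rintro rfl; exact hL hl
      simp [StepLabel.disp, glueDisp, this]
  rw [cellAt, cellAt, hB, hrows]
  simp only [List.map_append, List.map_cons, hcongr _ hjA, hcongr _ hjB, StepLabel.disp]
  have e1 : glueDisp I j = (1, 1) := by simp [glueDisp, hI]
  have e2 : glueDisp (insert j I) j = (0, 1) := by simp [glueDisp]
  rw [e1, e2]
  generalize (seqLabels 1 (α.take j)).map (StepLabel.disp (glueDisp I)) = A
  generalize B.map (StepLabel.disp (glueDisp I)) = B
  -- Cells with index at most `A.length` precede the comma and lie weakly below the threshold; later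
  -- cells lie strictly above it, since the unglued comma step climbs one row.
  rcases le_or_gt p A.length with hp | hp
  · rw [List.take_append_of_le_length hp, List.take_append_of_le_length hp, shiftDown, if_pos]
    have : A.sum = (A.take p).sum + (A.drop p).sum := by
      rw [← List.sum_append, List.take_append_drop]
    rw [this]
    simp only [Prod.fst_add]
    omega
  · obtain ⟨d, rfl⟩ := Nat.exists_eq_add_of_lt hp
    simp only [List.take_append, add_assoc, List.take_of_length_le (Nat.le_add_right A.length _),
      Nat.add_sub_cancel_left, List.take_succ_cons, List.sum_append, List.sum_cons]
    rw [shiftDown, if_neg]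
    · ext <;> simp
      omega
    · simp only [Prod.fst_add]
      omega

/-- Used to compare the displacements (1, 1) and (1, 0) at the commas: the unglued diagram and the
ribbon of the concatenation have their cells in the same rows. -/
theorem fst_cellAt_congr {t : ℕ → ℕ × ℕ} (h : ∀ j, (s j).1 = (t j).1) (p : ℕ) :
    (cellAt s α p).1 = (cellAt t α p).1 := by
  simp only [cellAt, ← List.map_take, Prod.fst_add]
  congr 1
  induction (seqLabels 1 α).take p with
  | nil => rfl
  | cons l L ih => cases l <;> simp [StepLabel.disp, ih, h]

end Cells

/-! ### Reading words of tableaux -/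

/-- An enumeration of the cells of a diagram. -/
structure Reading (D : Finset (ℕ × ℕ)) (n : ℕ) where
  /-- the cells -/
  cell : Fin n → ℕ × ℕ
  inj : Function.Injective cell
  mem_iff : ∀ y, y ∈ D ↔ ∃ p, cell p = y

/-- A bijective filling `w` of enumerated cells is standard. -/
def IsStd {n : ℕ} (c : Fin n → ℕ × ℕ) (w : Equiv.Perm (Fin n)) : Prop :=
  (∀ p q, c q = ((c p).1, (c p).2 + 1) → w p < w q) ∧
    ∀ p q, c p = ((c q).1 + 1, (c q).2) → w p < w q

namespace Reading

variable {n : ℕ} {D : Finset (ℕ × ℕ)} (R : Reading D n)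

/-- The enumeration as a bijection. -/
def equiv : Fin n ≃ D :=
  Equiv.ofBijective (fun p => ⟨R.cell p, (R.mem_iff _).2 ⟨p, rfl⟩⟩)
    ⟨fun _ _ h => R.inj (congrArg Subtype.val h), fun y => by
      obtain ⟨p, hp⟩ := (R.mem_iff _).1 y.2
      exact ⟨p, Subtype.ext hp⟩⟩

@[simp]
theorem coe_equiv (p : Fin n) : (R.equiv p : ℕ × ℕ) = R.cell p := rfl

/-- The reading word of a tableau. -/
def word (T : StdTableau D n) : Equiv.Perm (Fin n) := R.equiv.trans T.fill

theorem pos_eq (T : StdTableau D n) (e : Fin n) : T.pos e = R.cell ((R.word T).symm e) := by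
  simp [StdTableau.pos, word, ← R.coe_equiv]

theorem isStd_word (T : StdTableau D n) : IsStd R.cell (R.word T) :=
  ⟨fun p q h => T.horiz (R.equiv p) (R.equiv q) h, fun p q h => T.vert (R.equiv p) (R.equiv q) h⟩

/-- The tableau with a given reading word. -/
def tab (w : Equiv.Perm (Fin n)) (hw : IsStd R.cell w) : StdTableau D n where
  fill := R.equiv.symm.trans w
  horiz x y h := hw.1 _ _ (by simpa [← R.coe_equiv] using h)
  vert x y h := hw.2 _ _ (by simpa [← R.coe_equiv] using h)

@[simp]
theorem word_tab (w : Equiv.Perm (Fin n)) (hw : IsStd R.cell w) : R.word (R.tab w hw) = w := by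
  ext; simp [word, tab]

theorem word_injective : Function.Injective R.word := fun T T' h =>
  StdTableau.ext_pos fun e => by rw [R.pos_eq, R.pos_eq, h]

end Reading

/-! ### Standardness as ascent conditions on reading words -/

section Param

variable {n : ℕ} {α : List Comp}

/-- Only an inequality, so that the empty sequence is covered: there n = 0, but the list of steps
has length 0 as well. -/
theorem le_length_seqLabels (hα : ∀ a ∈ α, a ≠ []) (hn : seqSize α = n) :
    n ≤ (seqLabels 1 α).length + 1 := by
  rcases eq_or_ne α [] with rfl | hne
  · simp [← hn, seqSize]
  · rw [length_seqLabels 1 α hα hne, hn]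

theorem mem_walk_iff_cellAt (s : ℕ → ℕ × ℕ) (hα : ∀ a ∈ α, a ≠ []) (hn : seqSize α = n)
    (hne : α ≠ []) (y : ℕ × ℕ) :
    y ∈ walk (1, 1) ((seqLabels 1 α).map (StepLabel.disp s)) ↔
      ∃ p : Fin n, cellAt s α p = y := by
  rw [mem_walk, List.length_map, length_seqLabels 1 α hα hne, hn]
  exact ⟨fun ⟨p, hp, h⟩ => ⟨⟨p, hp⟩, h⟩, fun ⟨p, h⟩ => ⟨p, p.2, h⟩⟩

/-- The enumeration of the cells of `Diag(α⃗(I))` from southwest to northeast. -/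
def glueReading (hα : ∀ a ∈ α, a ≠ []) (hn : seqSize α = n) (I : Finset ℕ) :
    Reading (diag (glueAt I α)) n where
  cell p := cellAt (glueDisp I) α p
  inj p q h := Fin.ext <| cellAt_inj (glueDisp_weight I)
    (by have := le_length_seqLabels hα hn; omega) (by have := le_length_seqLabels hα hn; omega) h
  mem_iff y := by
    -- A walk always visits its starting cell, so the empty diagram has to be treated separately.
    rcases eq_or_ne α [] with rfl | hne
    · have : n = 0 := by simp [← hn, seqSize]
      subst this
      simp [diag, glueAt, glueFrom, seqCells]
    · rw [diag, glueAt, List.mem_toFinset, seqCells_eq_walk 1 1 1 _ (glueFrom_mem_ne_nil _ _ _ hα)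
        (glueFrom_ne_nil_of_ne_nil _ _ hne), map_disp_glueFrom I 1 1 _ hα,
        mem_walk_iff_cellAt _ hα hn hne]

/-- The enumeration of the cells of the ribbon of `α⁽¹⁾ ⋯ α⁽ˡ⁾` from southwest to northeast. -/
def flatReading (hα : ∀ a ∈ α, a ≠ []) (hn : seqSize α = n) :
    Reading (diag [α.flatten]) n where
  cell p := cellAt (fun _ => (1, 0)) α p
  inj p q h := Fin.ext <| cellAt_inj (fun _ => le_rfl)
    (by have := le_length_seqLabels hα hn; omega) (by have := le_length_seqLabels hα hn; omega) h
  mem_iff y := by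
    rcases eq_or_ne α [] with rfl | hne
    · have : n = 0 := by simp [← hn, seqSize]
      subst this
      simp [diag, seqCells, ribbonCells]
    · have hf : α.flatten ≠ [] := by
        obtain ⟨a, α, rfl⟩ := List.exists_cons_of_ne_nil hne
        simpa using fun h => absurd h (hα a (by simp))
      rw [diag, List.mem_toFinset, seqCells_eq_walk 1 1 1 _ (by simpa using hf) (by simp),
        seqLabels, map_disp_flatten _ 1 α hα, mem_walk_iff_cellAt _ hα hn hne]

/-- The word `w` satisfies the conditions of a standard tableau inside the components of `α⃗`. -/
def IsBase (α : List Comp) (w : Equiv.Perm (Fin n)) : Prop :=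
  ∀ p q : Fin n, (q : ℕ) = p + 1 →
    ((seqLabels 1 α)[(p : ℕ)]? = some .right → w p < w q) ∧
      ((seqLabels 1 α)[(p : ℕ)]? = some .up → w q < w p)

/-- The word `w` ascends at the `j`-th comma of `α⃗`. -/
def IsAscent (α : List Comp) (w : Equiv.Perm (Fin n)) (j : ℕ) : Prop :=
  ∃ p q : Fin n, (q : ℕ) = p + 1 ∧ (seqLabels 1 α)[(p : ℕ)]? = some (.comma j) ∧ w p < w q

theorem exists_comma_index {j : ℕ} (hα : ∀ a ∈ α, a ≠ []) (hn : seqSize α = n)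
    (hj : j ∈ Finset.Icc 1 (α.length - 1)) :
    ∃ p q : Fin n, (q : ℕ) = p + 1 ∧
      ∀ r : ℕ, (seqLabels 1 α)[r]? = some (.comma j) ↔ r = p := by
  obtain ⟨B, hB, hjA, hjB⟩ := exists_seqLabels_split α hj
  have hne : α ≠ [] := by rintro rfl; simp at hj
  have hlen := length_seqLabels 1 α hα hne
  set A := seqLabels 1 (α.take j)
  have hlen' : A.length + 1 < n := by
    rw [hB] at hlen
    simp only [List.length_append, List.length_cons] at hlen
    omega
  refine ⟨⟨A.length, by omega⟩, ⟨A.length + 1, hlen'⟩, rfl, fun r => ?_⟩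
  rw [hB]
  constructor
  · intro h
    rcases lt_trichotomy r A.length with hr | hr | hr
    · rw [List.getElem?_append_left hr] at h
      exact absurd (List.mem_of_getElem? h) hjA
    · exact hr
    · obtain ⟨d, rfl⟩ := Nat.exists_eq_add_of_lt hr
      rw [List.getElem?_append_right (by omega), add_assoc, Nat.add_sub_cancel_left,
        List.getElem?_cons_succ] at h
      exact absurd (List.mem_of_getElem? h) hjB
  · rintro rfl
    simp

/-- Adjacent cells are consecutive on the path (`cellAt_eq_add`), so standardness is local: a
horizontal step forces an ascent, a vertical one a descent, and any other displacement forces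
nothing. -/
theorem isStd_cellAt_iff {s : ℕ → ℕ × ℕ} (hs : ∀ j, 1 ≤ (s j).1 + (s j).2)
    (hα : ∀ a ∈ α, a ≠ []) (hn : seqSize α = n) (w : Equiv.Perm (Fin n)) :
    IsStd (fun p : Fin n => cellAt s α p) w ↔ ∀ p q : Fin n, (q : ℕ) = p + 1 →
      (((seqLabels 1 α)[(p : ℕ)]?).map (StepLabel.disp s) = some (0, 1) → w p < w q) ∧
      (((seqLabels 1 α)[(p : ℕ)]?).map (StepLabel.disp s) = some (1, 0) → w q < w p) := by
  have hl := le_length_seqLabels hα hn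
  have h1 : ∀ p q : Fin n, cellAt s α q = ((cellAt s α p).1, (cellAt s α p).2 + 1) ↔ _ :=
    fun p q => cellAt_eq_add (α := α) (d := (0, 1)) hs (by omega) (by omega) rfl
  have h2 : ∀ p q : Fin n, cellAt s α q = ((cellAt s α p).1 + 1, (cellAt s α p).2) ↔ _ :=
    fun p q => cellAt_eq_add (α := α) (d := (1, 0)) hs (by omega) (by omega) rfl
  simp only [IsStd, h1, h2]
  exact ⟨fun h p q hq => ⟨fun h' => h.1 p q ⟨hq, h'⟩, fun h' => h.2 q p ⟨hq, h'⟩⟩,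
    fun h => ⟨fun p q h' => (h p q h'.1).1 h'.2, fun p q h' => (h q p h'.1).2 h'.2⟩⟩

/-- A glued comma is a horizontal step and forces an ascent; an unglued one is diagonal and imposes
no condition. The bound on I ensures that each of its elements really labels a step. -/
theorem isStd_glue_iff (hα : ∀ a ∈ α, a ≠ []) (hn : seqSize α = n) {I : Finset ℕ}
    (hI : I ⊆ Finset.Icc 1 (α.length - 1)) (w : Equiv.Perm (Fin n)) :
    IsStd (glueReading hα hn I).cell w ↔ IsBase α w ∧ ∀ j ∈ I, IsAscent α w j := by
  refine (isStd_cellAt_iff (glueDisp_weight I) hα hn w).trans ⟨fun h => ⟨fun p q hq => ?_, ?_⟩, ?_⟩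
  · exact ⟨fun h' => (h p q hq).1 (by simp [h', StepLabel.disp]),
      fun h' => (h p q hq).2 (by simp [h', StepLabel.disp])⟩
  · intro j hj
    obtain ⟨p, q, hq, hp⟩ := exists_comma_index hα hn (hI hj)
    have hp := (hp p).2 rfl
    exact ⟨p, q, hq, hp, (h p q hq).1 (by simp [hp, StepLabel.disp, glueDisp, hj])⟩
  · rintro ⟨hb, ha⟩ p q hq
    rcases hl : (seqLabels 1 α)[(p : ℕ)]? with _ | l
    · simp
    · cases l with
      | right => simpa [StepLabel.disp] using (hb p q hq).1 hl
      | up => simpa [StepLabel.disp] using (hb p q hq).2 hl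
      | comma j =>
        by_cases hj : j ∈ I
        · obtain ⟨p₁, q₁, hq₁, hp₁, hlt⟩ := ha j hj
          obtain ⟨p₀, q₀, -, hp₀⟩ := exists_comma_index hα hn (hI hj)
          have e1 : p = p₁ := Fin.ext (((hp₀ p).1 hl).trans ((hp₀ p₁).1 hp₁).symm)
          have e2 : q = q₁ := Fin.ext (by rw [hq, hq₁, e1])
          simpa [StepLabel.disp, glueDisp, hj, e1, e2] using hlt
        · simp [StepLabel.disp, glueDisp, hj]

/-- Each comma is now a step up and forces a descent, which is the negation of an ascent because `w`
is injective. -/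
theorem isStd_flat_iff (hα : ∀ a ∈ α, a ≠ []) (hn : seqSize α = n) (w : Equiv.Perm (Fin n)) :
    IsStd (flatReading hα hn).cell w ↔
      IsBase α w ∧ ∀ j ∈ Finset.Icc 1 (α.length - 1), ¬ IsAscent α w j := by
  refine (isStd_cellAt_iff (fun _ => le_rfl) hα hn w).trans
    ⟨fun h => ⟨fun p q hq => ?_, ?_⟩, ?_⟩
  · exact ⟨fun h' => (h p q hq).1 (by simp [h', StepLabel.disp]),
      fun h' => (h p q hq).2 (by simp [h', StepLabel.disp])⟩
  · rintro j - ⟨p, q, hq, hp, hlt⟩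
    exact hlt.not_gt ((h p q hq).2 (by simp [hp, StepLabel.disp]))
  · rintro ⟨hb, ha⟩ p q hq
    rcases hl : (seqLabels 1 α)[(p : ℕ)]? with _ | l
    · simp
    · cases l with
      | right => simpa [StepLabel.disp] using (hb p q hq).1 hl
      | up => simpa [StepLabel.disp] using (hb p q hq).2 hl
      | comma j =>
        have hj := comma_mem_seqLabels (List.mem_of_getElem? hl)
        have hj := ha j (Finset.mem_Icc.2 (by omega))
        have hpq : w p ≠ w q := w.injective.ne (by rw [Ne, Fin.ext_iff]; omega)
        have : w q < w p := lt_of_le_of_ne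
          (not_lt.1 fun hlt => hj ⟨p, q, hq, hl, hlt⟩) hpq.symm
        simpa [StepLabel.disp] using this

end Param

instance {D : Finset (ℕ × ℕ)} {n : ℕ} : Finite (StdTableau D n) :=
  Finite.of_injective StdTableau.fill fun _ _ h => StdTableau.ext h

/-! ### Coefficients with respect to reading words -/

namespace Reading

variable (k : Type*) [Field k] {n : ℕ} {D : Finset (ℕ × ℕ)} (R : Reading D n)

open Classical in
/-- The coefficient of the tableau with reading word `w`, or `0` if there is none. -/
def coef (w : Equiv.Perm (Fin n)) : TabModule k n D →ₗ[k] k :=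
  TabModule.lift k fun T => if R.word T = w then 1 else 0

open Classical in
theorem coef_basisVec (w : Equiv.Perm (Fin n)) (T : StdTableau D n) :
    R.coef k w (TabModule.basisVec k T) = if R.word T = w then 1 else 0 :=
  TabModule.lift_basisVec k _ T

/-- Coefficients are indexed by all permutations, with value 0 at those that are not standard, so
that different shapes can be compared at the same `w`. -/
theorem coef_of_not (w : Equiv.Perm (Fin n)) (hw : ¬ IsStd R.cell w) : R.coef k w = 0 := by
  refine TabModule.hom_ext k fun T => ?_
  rw [coef_basisVec, if_neg, LinearMap.zero_apply]
  rintro rfl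
  exact hw (R.isStd_word T)

theorem ext_coef {x y : TabModule k n D} (h : ∀ w, R.coef k w x = R.coef k w y) : x = y := by
  have key : ∀ (T : StdTableau D n) (z : StdTableau D n →₀ k),
      R.coef k (R.word T) z = z T := by
    intro T z
    classical
    have : R.coef k (R.word T) z = z.sum fun T' c => c * if R.word T' = R.word T then 1 else 0 :=
      Finsupp.linearCombination_apply k z
    rw [this, Finsupp.sum_eq_single T]
    · simp
    · intro T' _ hT'
      simp [R.word_injective.ne hT']
    · simp
  exact Finsupp.ext (f := (x : StdTableau D n →₀ k)) fun T =>
    (key T x).symm.trans ((h _).trans (key T y))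

/-- The vector with prescribed coefficients. -/
def vec (f : Equiv.Perm (Fin n) → k) : TabModule k n D :=
  ∑ᶠ T : StdTableau D n, f (R.word T) • TabModule.basisVec k T

open Classical in
theorem coef_vec (f : Equiv.Perm (Fin n) → k) (w : Equiv.Perm (Fin n)) :
    R.coef k w (R.vec k f) = if IsStd R.cell w then f w else 0 := by
  split_ifs with hw
  · have := Fintype.ofFinite (StdTableau D n)
    rw [vec, finsum_eq_sum_of_fintype, map_sum, Finset.sum_eq_single (R.tab w hw)]
    · simp [coef_basisVec]
    · intro T _ hT
      rw [map_smul, coef_basisVec, if_neg, smul_zero]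
      rintro rfl
      exact hT (R.word_injective (by simp))
    · simp
  · rw [R.coef_of_not k w hw, LinearMap.zero_apply]

end Reading

/-! ### The differential in coefficients -/

section Complex

variable (k : Type*) [Field k] {n : ℕ} {α : List Comp} {i : ℕ}

open Classical in
-- Translating the cells down keeps the entry of the p-th cell for every p (`shiftDown_cellAt`), so
-- φ_j fixes reading words: it projects onto those that remain standard after gluing.
theorem coef_phi (hα : ∀ a ∈ α, a ≠ []) (hn : seqSize α = n) (I : CommaSets α i)
    (j : FreeCommas α I.1) (w : Equiv.Perm (Fin n)) (x : P k n (glueAt I.1 α)) :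
    (glueReading hα hn (insert j.1 I.1)).coef k w (phi k n α I.1 j.1 j.one_le j.notMem x) =
      if IsStd (glueReading hα hn (insert j.1 I.1)).cell w then
        (glueReading hα hn I.1).coef k w x else 0 := by
  set R := glueReading hα hn I.1
  set R' := glueReading hα hn (insert j.1 I.1)
  have hj := Finset.mem_sdiff.1 j.2
  have hcell : ∀ p, shiftDown (rowsBelow α I.1 j.1) (R.cell p) = R'.cell p :=
    fun p => shiftDown_cellAt hα I.1 hj.1 hj.2 p
  change R'.coef k w (glueLin k _ _ (rowsBelow α I.1 j.1) x) = _
  split_ifs with hw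
  · suffices (R'.coef k w).comp (glueLin k _ _ (rowsBelow α I.1 j.1)) = R.coef k w from
      LinearMap.congr_fun this x
    refine TabModule.hom_ext k fun T => ?_
    rw [LinearMap.comp_apply, R.coef_basisVec k]
    by_cases hT : ∃ T' : StdTableau (diag (glueAt (insert j.1 I.1) α)) n,
      ∀ e, T'.pos e = shiftDown (rowsBelow α I.1 j.1) (T.pos e)
    · obtain ⟨T', hT'⟩ := hT
      have : R'.word T' = R.word T := by
        apply Equiv.symm_bijective.injective
        ext1 e
        apply R'.inj
        rw [← R'.pos_eq, hT', R.pos_eq, hcell]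
      rw [glueLin_of_pos k hT', R'.coef_basisVec k, this]
    · rw [glueLin_of_not k hT, map_zero, if_neg]
      -- If the reading word of `T` were standard for the glued shape, its tableau there would be
      -- the missing `T↓`.
      rintro rfl
      exact hT ⟨R'.tab _ hw, fun e => by rw [R'.pos_eq, R.pos_eq, hcell, R'.word_tab]⟩
  · rw [R'.coef_of_not k w hw, LinearMap.zero_apply]

open Classical in
/-- The coefficient in `C_i(α⃗)` of the tableau in `P_{α⃗(J)}` with reading word `w`. -/
def termCoef (hα : ∀ a ∈ α, a ≠ []) (hn : seqSize α = n) (J : Finset ℕ)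
    (w : Equiv.Perm (Fin n)) : Term k n α i →+ k :=
  DirectSum.toAddMonoid fun I =>
    if I.1 = J then ((glueReading hα hn I.1).coef k w).toAddMonoidHom else 0

variable (hα : ∀ a ∈ α, a ≠ []) (hn : seqSize α = n)

open Classical in
theorem termCoef_of (J : Finset ℕ) (w : Equiv.Perm (Fin n)) (I : CommaSets α i)
    (y : P k n (glueAt I.1 α)) :
    termCoef k hα hn J w (DirectSum.of (fun I : CommaSets α i => P k n (glueAt I.1 α)) I y) =
      if I.1 = J then (glueReading hα hn I.1).coef k w y else 0 := by
  rw [termCoef, DirectSum.toAddMonoid_of]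
  split_ifs <;> rfl

/-- Since `termCoef` takes an arbitrary finite set, sets such as `J.erase j` can be inserted and
rewritten without transport between summands; this lemma ties it back to the components. -/
theorem termCoef_eq (J : CommaSets α i) (w : Equiv.Perm (Fin n)) (x : Term k n α i) :
    termCoef k hα hn J.1 w x = (glueReading hα hn J.1).coef k w (x J) := by
  classical
  induction x using DirectSum.induction_on with
  | zero => simp
  | of I y =>
    rw [termCoef_of]
    split_ifs with h
    · obtain rfl : I = J := Subtype.ext h
      rw [DirectSum.of_eq_same]
    · rw [DirectSum.of_eq_of_ne _ _ _ (fun h' => h (congrArg Subtype.val h').symm), map_zero]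
  | add x y hx hy => rw [map_add, hx, hy, DirectSum.add_apply, map_add]

theorem ext_termCoef {x y : Term k n α i}
    (h : ∀ (J : CommaSets α i) (w : Equiv.Perm (Fin n)),
      termCoef k hα hn J.1 w x = termCoef k hα hn J.1 w y) : x = y := by
  refine DFinsupp.ext fun J => (glueReading hα hn J.1).ext_coef k fun w => ?_
  have := h J w
  rwa [termCoef_eq, termCoef_eq] at this

theorem termCoef_of_not (J : CommaSets α i) {w : Equiv.Perm (Fin n)}
    (hw : ¬ IsStd (glueReading hα hn J.1).cell w) (x : Term k n α i) :
    termCoef k hα hn J.1 w x = 0 := by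
  rw [termCoef_eq, Reading.coef_of_not k _ w hw, LinearMap.zero_apply]

/-- The cochain with prescribed coefficients. -/
def termVec (f : Finset ℕ → Equiv.Perm (Fin n) → k) : Term k n α i :=
  ∑ I : CommaSets α i, DirectSum.of (fun I : CommaSets α i => P k n (glueAt I.1 α)) I
    ((glueReading hα hn I.1).vec k (f I.1))

open Classical in
theorem termCoef_termVec (f : Finset ℕ → Equiv.Perm (Fin n) → k) (J : CommaSets α i)
    (w : Equiv.Perm (Fin n)) :
    termCoef k hα hn J.1 w (termVec k hα hn f : Term k n α i) =
      if IsStd (glueReading hα hn J.1).cell w then f J.1 w else 0 := by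
  rw [termVec, map_sum, Finset.sum_eq_single J]
  · rw [termCoef_of, if_pos rfl, Reading.coef_vec]
  · intro I _ hI
    rw [termCoef_of, if_neg fun h => hI (Subtype.ext h)]
  · simp

open Classical in
-- The transposed form of the definition: the component at J receives contributions from the sets
-- obtained by removing one element of J.
theorem termCoef_differential (J : CommaSets α (i + 1)) (w : Equiv.Perm (Fin n))
    (x : Term k n α i) :
    termCoef k hα hn J.1 w (differential k n α i x) =
      if IsStd (glueReading hα hn J.1).cell w then
        ∑ j ∈ J.1, (sgn j (J.1.erase j) : k) * termCoef k hα hn (J.1.erase j) w x else 0 := by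
  induction x using DirectSum.induction_on with
  | zero => simp
  | add x y hx hy =>
    rw [map_add, map_add, hx, hy]
    split_ifs
    · simp only [map_add, mul_add, Finset.sum_add_distrib]
    · simp
  | of I y =>
    -- Only the coefficients of the images under φ_j matter from here on; hiding the maps avoids
    -- rewriting inside dependent types.
    obtain ⟨φ, hφ, hd⟩ : ∃ φ : ∀ j : FreeCommas α I.1, P k n (glueAt (I.insert j).1 α),
        (∀ j, (glueReading hα hn (I.insert j).1).coef k w (φ j) =
          if IsStd (glueReading hα hn (I.insert j).1).cell w then
            (glueReading hα hn I.1).coef k w y else 0) ∧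
        differential k n α i
          (DirectSum.of (fun I : CommaSets α i => P k n (glueAt I.1 α)) I y) =
          ∑ j : FreeCommas α I.1, sgn j.1 I.1 •
            DirectSum.of (fun J : CommaSets α (i + 1) => P k n (glueAt J.1 α)) (I.insert j)
              (φ j) := by
      refine ⟨fun j => phi k n α I.1 j.1 j.one_le j.notMem y,
        fun j => coef_phi k hα hn I j w y, ?_⟩
      have := DirectSum.toModule_lof (HeckeZero k n) (ι := CommaSets α i)
        (M := fun I => P k n (glueAt I.1 α)) (N := Term k n α (i + 1))
        (φ := fun I => ∑ j : FreeCommas α I.1, sgn j.1 I.1 •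
          (DirectSum.lof (HeckeZero k n) (CommaSets α (i + 1)) (fun J => P k n (glueAt J.1 α))
            (I.insert j)).comp (phi k n α I.1 j.1 j.one_le j.notMem)) I y
      refine this.trans ?_
      simp only [LinearMap.sum_apply, LinearMap.smul_apply]
      rfl
    rw [hd, map_sum]
    simp only [map_zsmul, termCoef_of, hφ, zsmul_eq_mul]
    have hIJ : ∀ j : FreeCommas α I.1, (I.insert j).1 = J.1 ↔ insert j.1 I.1 = J.1 :=
      fun j => Iff.rfl
    split_ifs with hw
    · have hI := (Finset.mem_powersetCard.1 I.2).1
      have hJ := (Finset.mem_powersetCard.1 J.2).1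
      trans ∑ j ∈ Finset.Icc 1 (α.length - 1) \ I.1,
        if insert j I.1 = J.1 then (sgn j I.1 : k) * (glueReading hα hn I.1).coef k w y else 0
      · refine Eq.trans (Finset.sum_congr rfl fun j _ => ?_) (Finset.sum_coe_sort
          (Finset.Icc 1 (α.length - 1) \ I.1) fun j => if insert j I.1 = J.1 then
            (sgn j I.1 : k) * (glueReading hα hn I.1).coef k w y else 0)
        by_cases h : insert j.1 I.1 = J.1
        · rw [if_pos ((hIJ j).2 h), if_pos h, if_pos]
          rwa [(hIJ j).2 h]
        · rw [if_neg (mt (hIJ j).1 h), if_neg h, mul_zero]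
      -- Reindexing: the j outside I with I ∪ {j} = J are the j in J with J \ {j} = I.
      · simp only [mul_ite, mul_zero]
        rw [← Finset.sum_filter, ← Finset.sum_filter]
        refine Finset.sum_congr (Finset.ext fun j => ?_) fun j hj => ?_
        · simp only [Finset.mem_filter, Finset.mem_sdiff]
          constructor
          · rintro ⟨⟨-, h1⟩, h2⟩
            rw [← h2]
            simp [h1]
          · rintro ⟨h1, h2⟩
            rw [h2]
            simp [h1, Finset.mem_Icc.1 (hJ h1), Finset.insert_erase]
        · rw [← (Finset.mem_filter.1 hj).2]
    · refine Finset.sum_eq_zero fun j _ => ?_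
      split_ifs with h1 h2
      · rw [h1] at h2
        exact absurd h2 hw
      · simp
      · simp

end Complex

/-! ### Signs -/

theorem sgn_erase_of_le {t s : ℕ} (I : Finset ℕ) (h : t ≤ s) : sgn t (I.erase s) = sgn t I := by
  rw [sgn, sgn]
  congr 2
  ext r
  simp only [Finset.mem_filter, Finset.mem_erase]
  constructor
  · rintro ⟨⟨-, h1⟩, h2⟩
    exact ⟨h1, h2⟩
  · rintro ⟨h1, h2⟩
    exact ⟨⟨by omega, h1⟩, h2⟩

theorem sgn_erase_of_lt {t s : ℕ} {I : Finset ℕ} (hs : s ∈ I) (h : s < t) :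
    sgn t (I.erase s) = -sgn t I := by
  have : I.filter (· < t) = insert s ((I.erase s).filter (· < t)) := by
    ext r
    simp only [Finset.mem_filter, Finset.mem_insert, Finset.mem_erase]
    by_cases hr : r = s
    · subst hr; simp [hs, h]
    · simp [hr]
  rw [sgn, sgn, this, Finset.card_insert_of_notMem (by simp), pow_succ]
  simp

theorem sgn_eq_one {t : ℕ} {I : Finset ℕ} (h : ∀ r ∈ I, t ≤ r) : sgn t I = 1 := by
  have : I.filter (· < t) = ∅ := Finset.filter_eq_empty_iff.2 fun r hr => not_lt.2 (h r hr)
  simp [sgn, this]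

/-- The alternating sum that expresses `∂ ∘ ∂ = 0`. -/
theorem sum_sgn_mul_sgn (k : Type*) [CommRing k] (J : Finset ℕ) (f : Finset ℕ → k) :
    ∑ j ∈ J, (sgn j J : k) * ∑ t ∈ J.erase j, (sgn t (J.erase j) : k) * f ((J.erase j).erase t) =
      0 := by
  simp only [Finset.mul_sum]
  rw [Finset.sum_sigma']
  -- Exchange the order in which the two elements are removed; exactly one of the two signs changes,
  -- so the terms cancel in pairs.
  refine Finset.sum_involution (fun p _ => ⟨p.2, p.1⟩) ?_ ?_ ?_ ?_
  · rintro ⟨j, t⟩ h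
    simp only [Finset.mem_sigma, Finset.mem_erase] at h
    obtain ⟨hj, htj, ht⟩ := h
    simp only
    rw [Finset.erase_right_comm (a := t)]
    rcases lt_or_gt_of_ne htj with hlt | hlt
    · rw [sgn_erase_of_le J hlt.le, sgn_erase_of_lt ht hlt]
      push_cast
      ring
    · rw [sgn_erase_of_le J hlt.le, sgn_erase_of_lt hj hlt]
      push_cast
      ring
  · rintro ⟨j, t⟩ h _ h'
    simp only [Finset.mem_sigma, Finset.mem_erase] at h
    simp only [Sigma.mk.injEq] at h'
    exact h.2.1 h'.1
  · rintro ⟨j, t⟩ h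
    simp only [Finset.mem_sigma, Finset.mem_erase] at h ⊢
    exact ⟨h.2.2, h.2.1.symm, h.1⟩
  · rintro ⟨j, t⟩ _
    rfl

/-! ### ∂² = 0 and acyclicity in positive degrees -/

section Complex

variable (k : Type*) [Field k] {n : ℕ} {α : List Comp} {i : ℕ}
  (hα : ∀ a ∈ α, a ≠ []) (hn : seqSize α = n)

theorem IsStd.mono {I J : Finset ℕ} (hIJ : I ⊆ J) (hJ : J ⊆ Finset.Icc 1 (α.length - 1))
    {w : Equiv.Perm (Fin n)} (hw : IsStd (glueReading hα hn J).cell w) :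
    IsStd (glueReading hα hn I).cell w := by
  rw [isStd_glue_iff hα hn hJ] at hw
  rw [isStd_glue_iff hα hn (hIJ.trans hJ)]
  exact ⟨hw.1, fun j hj => hw.2 j (hIJ hj)⟩

theorem erase_mem_powersetCard {S J : Finset ℕ} (hJ : J ∈ S.powersetCard (i + 1)) {j : ℕ}
    (hj : j ∈ J) : J.erase j ∈ S.powersetCard i := by
  rw [Finset.mem_powersetCard] at *
  exact ⟨(Finset.erase_subset _ _).trans hJ.1, by rw [Finset.card_erase_of_mem hj, hJ.2]; rfl⟩

theorem termCoef_differential_of_isStd {J : Finset ℕ}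
    (hJ : J ∈ (Finset.Icc 1 (α.length - 1)).powersetCard (i + 1)) {w : Equiv.Perm (Fin n)}
    (hw : IsStd (glueReading hα hn J).cell w) (x : Term k n α i) :
    termCoef k hα hn J w (differential k n α i x) =
      ∑ j ∈ J, (sgn j J : k) * termCoef k hα hn (J.erase j) w x := by
  rw [termCoef_differential k hα hn ⟨J, hJ⟩, if_pos hw]
  exact Finset.sum_congr rfl fun j _ => by rw [sgn_erase_of_le J le_rfl]

/-- A word standard for J is standard for every subset of J, so the summation formula applies at
both stages and leaves the alternating sum. -/
theorem differential_differential (hα : ∀ a ∈ α, a ≠ []) (hn : seqSize α = n)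
    (x : Term k n α i) :
    differential k n α (i + 1) (differential k n α i x) = 0 := by
  refine ext_termCoef k hα hn fun J w => ?_
  rw [map_zero]
  by_cases hw : IsStd (glueReading hα hn J.1).cell w
  · rw [termCoef_differential_of_isStd k hα hn J.2 hw,
      ← sum_sgn_mul_sgn k J.1 fun I => termCoef k hα hn I w x]
    refine Finset.sum_congr rfl fun j hj => ?_
    rw [termCoef_differential_of_isStd k hα hn (erase_mem_powersetCard J.2 hj)
      (hw.mono hα hn (Finset.erase_subset _ _) (Finset.mem_powersetCard.1 J.2).1)]
  · exact termCoef_of_not k hα hn J hw _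

open Classical in
/-- The commas at which the word `w` ascends. -/
def ascents (α : List Comp) (w : Equiv.Perm (Fin n)) : Finset ℕ :=
  (Finset.Icc 1 (α.length - 1)).filter (IsAscent α w)

theorem ascents_subset (w : Equiv.Perm (Fin n)) : ascents α w ⊆ Finset.Icc 1 (α.length - 1) := by
  classical exact Finset.filter_subset _ _

/-- For a fixed word, the admissible sets I form a full power set; this is the simplex behind the
acyclicity. -/
theorem isStd_glue_iff_subset_ascents {I : Finset ℕ} (hI : I ⊆ Finset.Icc 1 (α.length - 1))
    (w : Equiv.Perm (Fin n)) :
    IsStd (glueReading hα hn I).cell w ↔ IsBase α w ∧ I ⊆ ascents α w := by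
  rw [isStd_glue_iff hα hn hI]
  refine and_congr_right fun _ => forall₂_congr fun j hj => ?_
  classical rw [ascents, Finset.mem_filter, and_iff_right (hI hj)]

/-- The coefficients of the image of a cochain under the contracting homotopy, which removes the
first comma at which the word ascends. -/
def homotopyCoef (x : Term k n α (i + 1)) (I : Finset ℕ) (w : Equiv.Perm (Fin n)) : k :=
  if h : (ascents α w).Nonempty then
    if (ascents α w).min' h ∈ I then 0
    else termCoef k hα hn (insert ((ascents α w).min' h) I) w x
  else 0

/-- Let m be the least ascending comma of `w`. The homotopy h, with (hx)_I = x_{I ∪ {m}} for m ∉ I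
and 0 otherwise, satisfies h∂ + ∂h = 1 on the part of `w`, so a cocycle x is the coboundary of hx.
As m depends on `w`, h is only used as a map of coefficients; linearity over H_n(0) is not needed
for exactness. -/
theorem exists_differential_eq (hα : ∀ a ∈ α, a ≠ []) (hn : seqSize α = n)
    (x : Term k n α (i + 1)) (hx : differential k n α (i + 1) x = 0) :
    ∃ y, differential k n α i y = x := by
  refine ⟨termVec k hα hn (homotopyCoef k hα hn x), ext_termCoef k hα hn fun J w => ?_⟩
  by_cases hw : IsStd (glueReading hα hn J.1).cell w
  swap
  · rw [termCoef_of_not k hα hn J hw, termCoef_of_not k hα hn J hw]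
  obtain ⟨hJ, hcard⟩ := Finset.mem_powersetCard.1 J.2
  obtain ⟨hb, hasc⟩ := (isStd_glue_iff_subset_ascents hα hn hJ w).1 hw
  -- Positive degree enters here: J has i + 1 elements, all of them ascents.
  have hne : (ascents α w).Nonempty := (Finset.card_pos.1 (by omega)).mono hasc
  have hmem := (ascents α w).min'_mem hne
  have hmin : ∀ r ∈ ascents α w, (ascents α w).min' hne ≤ r :=
    fun r hr => (ascents α w).min'_le r hr
  rw [termCoef_differential_of_isStd k hα hn J.2 hw]
  have hy : ∀ j ∈ J.1, termCoef k hα hn (J.1.erase j) w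
      (termVec k hα hn (homotopyCoef k hα hn x) : Term k n α i) =
      if (ascents α w).min' hne ∈ J.1.erase j then 0
      else termCoef k hα hn (insert ((ascents α w).min' hne) (J.1.erase j)) w x := by
    intro j hj
    rw [termCoef_termVec k hα hn _ ⟨J.1.erase j, erase_mem_powersetCard J.2 hj⟩,
      if_pos (hw.mono hα hn (Finset.erase_subset _ _) hJ), homotopyCoef, dif_pos hne]
  rw [Finset.sum_congr rfl fun j hj => by rw [hy j hj]]
  generalize (ascents α w).min' hne = m at hmem hmin
  by_cases hm : m ∈ J.1
  -- Every other J \ {j} still contains m, where the homotopy vanishes; minimality makes the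
  -- remaining sign +1.
  · rw [Finset.sum_eq_single_of_mem m hm, if_neg (by simp), Finset.insert_erase hm,
      sgn_eq_one fun r hr => hmin r (hasc hr)]
    · simp
    · intro j _ hjm
      rw [if_pos (Finset.mem_erase.2 ⟨hjm.symm, hm⟩), mul_zero]
  · have hK : insert m J.1 ⊆ ascents α w := Finset.insert_subset hmem hasc
    have hK' := hK.trans (ascents_subset w)
    -- The cocycle condition at J ∪ {m} expresses x_J through the other x_{(J ∪ {m}) \ {j}}. Adding
    -- m < j to J reverses the sign of j, which absorbs the minus sign.
    have hdx := termCoef_differential_of_isStd k hα hn (i := i + 1) (J := insert m J.1) (w := w)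
      (Finset.mem_powersetCard.2 ⟨hK', by rw [Finset.card_insert_of_notMem hm, hcard]⟩)
      ((isStd_glue_iff_subset_ascents hα hn hK' w).2 ⟨hb, hK⟩) x
    rw [hx, map_zero, Finset.sum_insert hm, sgn_eq_one fun r hr => hmin r (hK hr),
      Finset.erase_insert hm, Int.cast_one, one_mul] at hdx
    rw [eq_neg_of_add_eq_zero_left hdx.symm, ← Finset.sum_neg_distrib]
    refine Finset.sum_congr rfl fun j hj => ?_
    have hjm : m ≠ j := by rintro rfl; exact hm hj
    have hlt : m < j := lt_of_le_of_ne (hmin j (hasc hj)) hjm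
    have hs := sgn_erase_of_lt (Finset.mem_insert_self m J.1) hlt
    rw [Finset.erase_insert hm] at hs
    rw [if_neg fun h => hm (Finset.mem_of_mem_erase h), hs, Finset.erase_insert_of_ne hjm]
    push_cast
    ring

end Complex

/-! ### Degree zero -/

namespace Reading

variable (k : Type*) [Field k] {n : ℕ} {D D' : Finset (ℕ × ℕ)} (R : Reading D n)
  (R' : Reading D' n) (hstd : ∀ w, IsStd R.cell w → IsStd R'.cell w)

/-- Tableaux are sent to the tableaux of another shape with the same reading word. -/
def transfer : TabModule k n D →ₗ[k] TabModule k n D' :=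
  TabModule.lift k fun T => TabModule.basisVec k (R'.tab (R.word T) (hstd _ (R.isStd_word T)))

theorem transfer_basisVec (T : StdTableau D n) :
    R.transfer k R' hstd (TabModule.basisVec k T) =
      TabModule.basisVec k (R'.tab (R.word T) (hstd _ (R.isStd_word T))) :=
  TabModule.lift_basisVec k _ T

theorem coef_transfer (w : Equiv.Perm (Fin n)) (x : TabModule k n D) :
    R'.coef k w (R.transfer k R' hstd x) = R.coef k w x := by
  suffices (R'.coef k w).comp (R.transfer k R' hstd) = R.coef k w from LinearMap.congr_fun this x
  refine TabModule.hom_ext k fun T => ?_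
  rw [LinearMap.comp_apply, transfer_basisVec, coef_basisVec, coef_basisVec, word_tab]

/-- The three cases of π̄_i depend only on rows, which agree cell by cell, and s_i acts on reading
words in the same way for both shapes. -/
theorem transfer_piBar (hrow : ∀ p, (R.cell p).1 = (R'.cell p).1) (i : Fin (n - 1))
    (x : TabModule k n D) :
    R.transfer k R' hstd (piBar k i x) = piBar k i (R.transfer k R' hstd x) := by
  suffices (R.transfer k R' hstd).comp (piBar k i) = (piBar k i).comp (R.transfer k R' hstd) from
    LinearMap.congr_fun this x
  refine TabModule.hom_ext k fun T => ?_
  rw [LinearMap.comp_apply, LinearMap.comp_apply, transfer_basisVec]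
  set T' := R'.tab (R.word T) (hstd _ (R.isStd_word T)) with hT'
  have hr : ∀ e, T.row e = T'.row e := fun e => by
    rw [StdTableau.row, StdTableau.row, R.pos_eq, R'.pos_eq, hT', R'.word_tab, hrow]
  rcases lt_trichotomy (T.row (lo i)) (T.row (hi i)) with h | h | h
  · have h' : T'.row (lo i) < T'.row (hi i) := by rwa [← hr, ← hr]
    rw [piBar_of_lt k i h, piBar_of_lt k i h', transfer_basisVec]
    rfl
  · rw [piBar_of_eq k i h, map_zero, piBar_of_eq k i (by rwa [← hr, ← hr])]
  · rw [piBar_of_gt k i h, map_neg, transfer_basisVec, piBar_of_gt k i (by rwa [← hr, ← hr])]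

end Reading

section Complex

variable (k : Type*) [Field k] {n : ℕ} {α : List Comp}
  (hα : ∀ a ∈ α, a ≠ []) (hn : seqSize α = n)

theorem isStd_glue_empty_of_flat {w : Equiv.Perm (Fin n)}
    (hw : IsStd (flatReading hα hn).cell w) : IsStd (glueReading hα hn ∅).cell w :=
  (isStd_glue_iff hα hn (Finset.empty_subset _) w).2
    ⟨((isStd_flat_iff hα hn w).1 hw).1, by simp⟩

/-- The embedding of `P` of the concatenation into `P_{α⃗}`. -/
def flatToGlue : P k n [α.flatten] →ₗ[HeckeZero k n] P k n (glueAt ∅ α) where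
  toFun := (flatReading hα hn).transfer k (glueReading hα hn ∅)
    fun _ => isStd_glue_empty_of_flat hα hn
  map_add' := map_add _
  map_smul' := map_hecke_smul k _ ((flatReading hα hn).transfer_piBar k (glueReading hα hn ∅) _
    fun p => fst_cellAt_congr (fun j => by simp [glueDisp]) p)

/-- The empty set of commas. -/
def CommaSets.empty (α : List Comp) : CommaSets α 0 := ⟨∅, by simp⟩

theorem CommaSets.eq_empty (J : CommaSets α 0) : J = CommaSets.empty α :=
  Subtype.ext (Finset.card_eq_zero.1 (Finset.mem_powersetCard.1 J.2).2)

/-- The embedding of `P` of the concatenation into `C_0(α⃗)`. -/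
def flatToTerm : P k n [α.flatten] →ₗ[HeckeZero k n] Term k n α 0 :=
  (DirectSum.lof (HeckeZero k n) (CommaSets α 0) (fun J => P k n (glueAt J.1 α))
    (CommaSets.empty α)).comp (flatToGlue k hα hn)

theorem termCoef_flatToTerm (w : Equiv.Perm (Fin n)) (x : P k n [α.flatten]) :
    termCoef k hα hn ∅ w (flatToTerm k hα hn x) = (flatReading hα hn).coef k w x :=
  (termCoef_of k hα hn ∅ w (CommaSets.empty α) (flatToGlue k hα hn x)).trans
    ((if_pos rfl).trans (Reading.coef_transfer k _ _
      (fun _ => isStd_glue_empty_of_flat hα hn) w x))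

theorem flatToTerm_injective : Function.Injective (flatToTerm k hα hn) := fun x y h =>
  (flatReading hα hn).ext_coef k fun w => by
    rw [← termCoef_flatToTerm, ← termCoef_flatToTerm, h]

theorem differential_flatToTerm (x : P k n [α.flatten]) :
    differential k n α 0 (flatToTerm k hα hn x) = 0 := by
  refine ext_termCoef k hα hn fun J w => ?_
  rw [map_zero]
  by_cases hw : IsStd (glueReading hα hn J.1).cell w
  · obtain ⟨hJ, hcard⟩ := Finset.mem_powersetCard.1 J.2
    rw [termCoef_differential_of_isStd k hα hn J.2 hw]
    refine Finset.sum_eq_zero fun j hj => ?_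
    have he : J.1.erase j = ∅ := Finset.card_eq_zero.1 (by rw [Finset.card_erase_of_mem hj, hcard])
    rw [he, termCoef_flatToTerm, Reading.coef_of_not, LinearMap.zero_apply, mul_zero]
    intro hw'
    -- A word standard for the shape glued at j ascends there, while the concatenation demands a
    -- descent.
    exact ((isStd_flat_iff hα hn w).1 hw').2 j (hJ hj) (((isStd_glue_iff hα hn hJ w).1 hw).2 j hj)
  · exact termCoef_of_not k hα hn J hw _

theorem exists_flatToTerm_eq (x : Term k n α 0) (hx : differential k n α 0 x = 0) :
    ∃ y, flatToTerm k hα hn y = x := by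
  refine ⟨(flatReading hα hn).vec k fun w => termCoef k hα hn ∅ w x,
    ext_termCoef k hα hn fun J w => ?_⟩
  rw [J.eq_empty, CommaSets.empty, termCoef_flatToTerm, Reading.coef_vec]
  split_ifs with hw
  · rfl
  · by_cases hw' : IsStd (glueReading hα hn ∅).cell w
    · have hb := ((isStd_glue_iff hα hn (Finset.empty_subset _) w).1 hw').1
      rw [isStd_flat_iff hα hn] at hw
      push Not at hw
      obtain ⟨j, hj, hasc⟩ := hw hb
      have hJ : {j} ⊆ Finset.Icc 1 (α.length - 1) := Finset.singleton_subset_iff.2 hj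
      -- At a singleton {j} the formula has one term, so the cocycle condition kills the coefficient
      -- of every word that ascends at j.
      have := termCoef_differential_of_isStd k hα hn (i := 0) (J := {j}) (w := w)
        (Finset.mem_powersetCard.2 ⟨hJ, rfl⟩)
        ((isStd_glue_iff hα hn hJ w).2 ⟨hb, by simpa using hasc⟩) x
      rw [hx, map_zero, Finset.sum_singleton, sgn_eq_one (by simp), Int.cast_one, one_mul] at this
      simpa using this
    · exact (termCoef_of_not k hα hn (CommaSets.empty α) hw' x).symm

end Complex

end RibbonHecke

end

/-! ### Translation into exactness and homology -/

theorem mainTheorem1 {k : Type*} [Field k] (n : ℕ) (α : List RibbonHecke.Comp)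
    (hα : ∀ a ∈ α, a ≠ []) (hn : RibbonHecke.seqSize α = n) :
    ∃ hd : ∀ i : ℕ, RibbonHecke.differentialHom k n α i ≫
        RibbonHecke.differentialHom k n α (i + 1) = 0,
      (∀ i : ℕ, 0 < i →
        (CochainComplex.of (RibbonHecke.termObj k n α) (RibbonHecke.differentialHom k n α)
          hd).ExactAt i) ∧
      Nonempty ((CochainComplex.of (RibbonHecke.termObj k n α)
          (RibbonHecke.differentialHom k n α) hd).homology 0 ≅
        ModuleCat.of (RibbonHecke.HeckeZero k n) (RibbonHecke.P k n [α.flatten])) := by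
  have hd : ∀ i : ℕ, RibbonHecke.differentialHom k n α i ≫
      RibbonHecke.differentialHom k n α (i + 1) = 0 := fun i => by
    refine ModuleCat.hom_ext (LinearMap.ext fun x => ?_)
    exact RibbonHecke.differential_differential k hα hn x
  refine ⟨hd, fun i hi => ?_, ?_⟩
  · obtain ⟨i, rfl⟩ := Nat.exists_eq_succ_of_ne_zero hi.ne'
    rw [HomologicalComplex.exactAt_iff' _ i (i + 1) (i + 1 + 1) (by simp) (by simp),
      ShortComplex.moduleCat_exact_iff]
    intro x hx
    simp only [HomologicalComplex.shortComplexFunctor'_obj_f,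
      HomologicalComplex.shortComplexFunctor'_obj_g, CochainComplex.of_d] at hx ⊢
    exact RibbonHecke.exists_differential_eq k hα hn x hx
  · set K := CochainComplex.of (RibbonHecke.termObj k n α) (RibbonHecke.differentialHom k n α) hd
    have hK : K.d 0 1 = RibbonHecke.differentialHom k n α 0 :=
      CochainComplex.of_d (RibbonHecke.termObj k n α) (RibbonHecke.differentialHom k n α) 0
    let S : ShortComplex (ModuleCat (RibbonHecke.HeckeZero k n)) :=
      ShortComplex.mk (ModuleCat.ofHom (RibbonHecke.flatToTerm k hα hn))
        (show RibbonHecke.termObj k n α 0 ⟶ K.X 1 from K.d 0 1) (by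
          rw [hK]
          refine ModuleCat.hom_ext (LinearMap.ext fun x => ?_)
          exact RibbonHecke.differential_flatToTerm k hα hn x)
    have : Mono S.f := (ModuleCat.mono_iff_injective _).2
      (RibbonHecke.flatToTerm_injective k hα hn)
    have hS : S.Exact := by
      rw [ShortComplex.moduleCat_exact_iff]
      intro x hx
      change K.d 0 1 x = 0 at hx
      rw [hK] at hx
      exact RibbonHecke.exists_flatToTerm_eq k hα hn x hx
    -- In degree 0 nothing maps in, so the homology is the kernel of the first differential; the
    -- exact sequence `S` with injective first map exhibits the module of the concatenation as such
    -- a kernel too.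
    exact ⟨(K.isoHomologyπ₀).symm ≪≫
      (K.cyclesIsKernel 0 1 (by simp)).conePointUniqueUpToIso hS.fIsKernel⟩
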